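/- **Environment.** The state $\omega\in[0,1]$ has prior $F$ with a strictly positive density; $\mu_F$ denotes the probability measure of $F$. Receiver has actions $a_0,\dots,a_{n-1}$ $(n\ge 1)$, and there are cutoffs $0=\gamma_0\le\gamma_1\le\dots\le\gamma_n=1$ with $\gamma_{n-1}<1$ such that $a_i$ is optimal for Receiver if and only if the posterior mean $x$ of the state lies in $A_i=[\gamma_i,\gamma_{i+1}]$. Sender's payoff depends only on the action, with $0=v(a_0)<v(a_1)<\dots<v(a_{n-1})$. Let $u(x)=\max\{v(a_i):x\in A_i\}$, and say that $x$ *recommends* $a_i$ if $i$ is the largest index with $x\in A_i$. **Disclosure game.** Sender observes $\omega$ and sends a (possibly random) message $m$, a nonempty closed subset of $[0,1]$ with $\omega\in m$; Receiver observes $m$ and plays a (possibly mixed) action. A triple $(\sigma,\tau,p)$ of measurable strategies and a measurable belief system is a perfect Bayesian equilibrium if in every state Sender only uses messages that maximize her expected payoff among all messages containing the state; if after every $m$ Receiver only plays actions $a_i$ with $A_i\ni$ the mean of $p(m)$; if the support of $p(m)$ is contained in $m$ for every $m$; and if $p$ is obtained from $F$ and $\sigma$ by Bayes' rule (it is a conditional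 distribution of the state given the message). Its outcome is $(G,R)$, where $G$ is the distribution of Receiver's posterior mean and $R$ is Sender's ex ante payoff. **Information design.** The problem is to maximize $\int u\,dG$ over the set $\mathrm{MPC}(F)$ of mean-preserving contractions of $F$. A *bi-pooling solution* is a solution $G$ of it for which there is a collection of nondegenerate intervals $[\underline\omega_q,\overline\omega_q]\subseteq[0,1]$ with pairwise disjoint interiors such that, on the interior of each of them, $G$ has the same mass and the same mean as $F$ and a support of at most two points, while $G=F$ outside the interiors. The interval is a *pooling* or a *bi-pooling* interval according as that support has one or two points. $G$ is *implementable* if $(G,R)$, with $R$ the value of the problem, is the outcome of some perfect Bayesian equilibrium. **Representations.** A *deterministic representation* of $G$ consists of closed sets $B_0,\dots,B_{n-1}$ (some may be empty) covering $[0,1]$ with $\mu_F(B_i\cap B_j)=0$ for $i\ne j$, such that, if $j=\min\{i:\operatorname{int}B_i\ne\varnothing\}$, then $\mathbb E[\omega\mid B_j]\ge\gamma_j$ and $\mathbb E[\omega\mid B_i]=\gamma_i$ for all $i>j$ with $\mu_F(B_i)>0$, and such that, for some collection of intervals as above: almost every $\omega$ outside the interiors of the intervals lies in the $B_i$ for which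 $\omega$ recommends $a_i$; each pooling interval is contained in the $B_i$ for which its posterior mean recommends $a_i$; and each bi-pooling interval $[\underline\omega,\overline\omega]$ with support points $z_L<z_H$ is a union of two closed sets $C_L,C_H$ with $\mu_F(C_L\cap C_H)=0$, $\mathbb E[\omega\mid C_L]=z_L$, $\mathbb E[\omega\mid C_H]=z_H$, contained in the sets $B_i$ of the actions that $z_L$ and $z_H$ recommend. It is a *canonical representation* if in each bi-pooling interval one can take $C_L=[\underline b,\overline b]$ and $C_H=[\underline\omega,\underline b]\cup[\overline b,\overline\omega]$ for some $\underline\omega\le\underline b\le\overline b\le\overline\omega$. A representation is *incentive compatible* if $A_i\subseteq\bigcup_{j\ge i}B_j$ for every $i=0,\dots,n-1$. **Proposition.** Every bi-pooling solution $G$ has a canonical representation, and for every canonical representation $\{B_i\}_{i=0}^{n-1}$ of $G$: $G$ is implementable if and only if $\{B_i\}_{i=0}^{n-1}$ is incentive compatible. -/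

import Mathlib

open MeasureTheory ProbabilityTheory Set TopologicalSpace
open scoped NNReal ENNReal unitInterval

noncomputable section

/-- Messages: nonempty closed (equivalently, nonempty compact) subsets of the state space `[0,1]`,
with the topology of the Hausdorff distance. -/
abbrev Message : Type := NonemptyCompacts I

/-- The Borel sigma-algebra of the space of messages. -/
instance Message.instMeasurableSpace : MeasurableSpace Message := borel Message

instance Message.instBorelSpace : BorelSpace Message := ⟨rfl⟩

/-- The data of the communication environment with `n` actions `a_0, ..., a_{n-1}`: a prior with a
strictly positive density `f` on `[0,1]`, cutoffs `0 = γ_0 ≤ γ_1 ≤ ... ≤ γ_n = 1`, and Sender's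
payoffs `0 = v(a_0) < v(a_1) < ... < v(a_{n-1})`. -/
structure Environment (n : ℕ) where
  f : I → ℝ≥0
  measurable_f : Measurable f
  f_pos : ∀ ω, 0 < f ω
  lintegral_f : ∫⁻ ω, (f ω : ℝ≥0∞) = 1
  γ : Fin (n + 1) → ℝ
  γ_zero : γ 0 = 0
  γ_last : γ (Fin.last n) = 1
  γ_mono : Monotone γ
  v : Fin n → ℝ
  v_zero : ∀ i : Fin n, (i : ℕ) = 0 → v i = 0
  v_strictMono : StrictMono v

namespace Environment

variable {n : ℕ} (E : Environment n)

/-- The prior probability measure `μ_F` on `[0,1]`. -/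
def prior : Measure I := (volume : Measure I).withDensity (fun ω => (E.f ω : ℝ≥0∞))

/-- The set `A_i = [γ_i, γ_{i+1}]` of posterior means at which `a_i` is optimal for Receiver. -/
def A (i : Fin n) : Set ℝ := Icc (E.γ i.castSucc) (E.γ i.succ)

/-! ### The verifiable disclosure game -/

/-- Posterior mean of the state under the belief `p m` held after the message `m`. -/
def postMean (p : Kernel Message I) (m : Message) : ℝ := ∫ ω, (ω : ℝ) ∂(p m)

/-- Sender's expected payoff when Receiver answers the message `m` with the mixed action `τ m`. -/
def payoff (τ : Kernel Message (Fin n)) (m : Message) : ℝ := ∑ i, (τ m).real {i} * E.v i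

/-- `(κ, τ, p)`, with `κ` the strategy of Sender, `τ` that of Receiver and `p` the belief system, is a
perfect Bayesian equilibrium. -/
structure IsEquilibrium (κ : Kernel I Message) (τ : Kernel Message (Fin n))
    (p : Kernel Message I) : Prop where
  markov_κ : IsMarkovKernel κ
  markov_τ : IsMarkovKernel τ
  markov_p : IsMarkovKernel p
  /-- only messages that contain the true state are sent -/
  feasible : ∀ ω, ∀ᵐ m ∂(κ ω), ω ∈ m
  /-- in every state, only payoff maximizing feasible messages are sent -/
  sender_optimal : ∀ ω, ∀ᵐ m ∂(κ ω), ∀ m' : Message, ω ∈ m' → E.payoff τ m' ≤ E.payoff τ m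
  /-- after every message, Receiver only plays actions that are optimal given her belief -/
  receiver_optimal : ∀ m i, 0 < τ m {i} → postMean p m ∈ E.A i
  /-- states in which the message could not have been sent are deemed impossible -/
  belief_support : ∀ (ω : I) (m : Message), ω ∉ m → ω ∉ (p m).support
  /-- Bayes' rule: `p` is a conditional distribution of the state given the message -/
  bayes : (E.prior ⊗ₘ κ).map Prod.swap = (κ ∘ₘ E.prior) ⊗ₘ p

/-- `(G, R)` is an equilibrium outcome: some equilibrium induces the distribution `G` of
posterior means and the ex ante payoff `R` of Sender. -/
def IsEquilibriumOutcome (G : Measure I) (R : ℝ) : Prop :=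
  ∃ (κ : Kernel I Message) (τ : Kernel Message (Fin n)) (p : Kernel Message I),
    E.IsEquilibrium κ τ p ∧
    G.map (fun x : I => (x : ℝ)) = (κ ∘ₘ E.prior).map (postMean p) ∧
    R = ∫ m, E.payoff τ m ∂(κ ∘ₘ E.prior)

/-! ### The information design problem -/

/-- Sender's value function: her highest payoff from actions optimal at the posterior mean `x`. -/
def value (x : ℝ) : ℝ := ⨆ i : {i : Fin n // x ∈ E.A i}, E.v i

/-- The mean-preserving contractions of the prior, through integrals of distribution functions. -/
def MPC : Set (Measure I) :=
  {G | IsProbabilityMeasure G ∧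
    (∀ x : I, ∫ s in Iic x, G.real (Iic s) ≤ ∫ s in Iic x, E.prior.real (Iic s)) ∧
    ∫ s in Iic (1 : I), G.real (Iic s) = ∫ s in Iic (1 : I), E.prior.real (Iic s)}

/-- The objective of the information design problem. -/
def designPayoff (G : Measure I) : ℝ := ∫ x, E.value (x : ℝ) ∂G

/-- `G` solves the information design problem. -/
def IsOptimal (G : Measure I) : Prop :=
  G ∈ E.MPC ∧ ∀ H ∈ E.MPC, E.designPayoff H ≤ E.designPayoff G

/-- The value of the information design problem. -/
def commitmentPayoff : ℝ := sSup (E.designPayoff '' E.MPC)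

/-- An optimal `G` is implementable if the commitment outcome with signal distribution `G` is
an equilibrium outcome of the verifiable disclosure game. -/
def IsImplementable (G : Measure I) : Prop :=
  E.IsOptimal G ∧ E.IsEquilibriumOutcome G E.commitmentPayoff

/-! ### Bi-pooling solutions -/

/-- `S` is a collection of intervals with disjoint interiors (an interval being given by the pair
of its endpoints) that exhibits `G` as a bi-pooling distribution: `G` garbles the prior within each
interval (same mass, same mean), with at most two signals, and reveals the state elsewhere. -/
structure IsBiPoolingFamily (G : Measure I) (S : Set (I × I)) : Prop where
  lt : ∀ q ∈ S, q.1 < q.2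
  disjoint : S.PairwiseDisjoint (fun q => Ioo q.1 q.2)
  mass : ∀ q ∈ S, G (Ioo q.1 q.2) = E.prior (Ioo q.1 q.2)
  mean : ∀ q ∈ S, ∫ x in Ioo q.1 q.2, (x : ℝ) ∂G = ∫ x in Ioo q.1 q.2, (x : ℝ) ∂E.prior
  card_support : ∀ q ∈ S, (G.restrict (Ioo q.1 q.2)).support.encard ≤ 2
  reveal : G.restrict (⋃ q ∈ S, Ioo q.1 q.2)ᶜ = E.prior.restrict (⋃ q ∈ S, Ioo q.1 q.2)ᶜ

/-- A bi-pooling solution: a bi-pooling distribution that solves the information design problem. -/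
def IsBiPoolingSolution (G : Measure I) : Prop :=
  E.IsOptimal G ∧ ∃ S, E.IsBiPoolingFamily G S

/-! ### Deterministic and canonical representations -/

/-- `E[ω | ω ∈ B]` under the prior, for `B` of positive prior probability. -/
def condMean (B : Set I) : ℝ := ⨍ ω in B, (ω : ℝ) ∂E.prior

/-- The posterior mean `x` recommends `a_i`: among the actions optimal at `x`, Sender prefers
`a_i`. -/
def Recommends (x : ℝ) (i : Fin n) : Prop := x ∈ E.A i ∧ ∀ k, x ∈ E.A k → k ≤ i

/-- `{CL, CH}` is a bi-partition of the interval `[a, b]` with conditional means `zL`, `zH`. -/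
structure IsBiPartition (a b : I) (zL zH : ℝ) (CL CH : Set I) : Prop where
  closed_L : IsClosed CL
  closed_H : IsClosed CH
  union : CL ∪ CH = Icc a b
  null_inter : E.prior (CL ∩ CH) = 0
  mean_L : E.condMean CL = zL
  mean_H : E.condMean CH = zH

/-- `CL` is a subinterval of `[a, b]`, and `CH` is what remains of `[a, b]`. -/
def IsNestedIntervals (a b : I) (CL CH : Set I) : Prop :=
  ∃ x y : I, a ≤ x ∧ x ≤ y ∧ y ≤ b ∧ CL = Icc x y ∧ CH = Icc a x ∪ Icc y b

/-- The closed sets `B_0, ..., B_{n-1}` form a deterministic representation of the bi-pooling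
distribution `G` with pooling and bi-pooling intervals `S`: up to null sets, `B_i` consists of the
states in which `a_i` is recommended when a bi-partition is used in each bi-pooling interval. -/
structure IsDeterministicRep (G : Measure I) (S : Set (I × I)) (B : Fin n → Set I) : Prop where
  closed : ∀ i, IsClosed (B i)
  cover : ⋃ i, B i = univ
  null_inter : ∀ i j, i ≠ j → E.prior (B i ∩ B j) = 0
  /-- with `a_j` the lowest action that is not skipped, the conditional mean on `B_j` is at least
  `γ_j`, and that on `B_i` is `γ_i` for every higher action whose `B_i` is not null -/
  obedient : ∀ j, (interior (B j)).Nonempty → (∀ i < j, interior (B i) = ∅) →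
    E.γ j.castSucc ≤ E.condMean (B j) ∧
      ∀ i, j < i → E.prior (B i) ≠ 0 → E.condMean (B i) = E.γ i.castSucc
  /-- revealed states -/
  revealed : ∀ᵐ ω ∂E.prior, (∀ q ∈ S, ω ∉ Ioo q.1 q.2) → ∀ i, E.Recommends (ω : ℝ) i → ω ∈ B i
  /-- pooling intervals -/
  pooling : ∀ q ∈ S, ∀ z : I, (G.restrict (Ioo q.1 q.2)).support = {z} →
    ∀ i, E.Recommends (z : ℝ) i → Icc q.1 q.2 ⊆ B i
  /-- bi-pooling intervals -/
  biPooling : ∀ q ∈ S, ∀ zL zH : I, zL < zH → (G.restrict (Ioo q.1 q.2)).support = {zL, zH} →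
    ∀ iL iH, E.Recommends (zL : ℝ) iL → E.Recommends (zH : ℝ) iH →
      ∃ CL CH, E.IsBiPartition q.1 q.2 zL zH CL CH ∧ CL ⊆ B iL ∧ CH ⊆ B iH

/-- A canonical representation of `G`: a deterministic representation in which the bi-partition of
each bi-pooling interval is a nested intervals representation. -/
def IsCanonicalRep (G : Measure I) (B : Fin n → Set I) : Prop :=
  ∃ S, E.IsBiPoolingFamily G S ∧ E.IsDeterministicRep G S B ∧
    ∀ q ∈ S, ∀ zL zH : I, zL < zH → (G.restrict (Ioo q.1 q.2)).support = {zL, zH} →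
      ∀ iL iH, E.Recommends (zL : ℝ) iL → E.Recommends (zH : ℝ) iH →
        ∃ CL CH, E.IsBiPartition q.1 q.2 zL zH CL CH ∧ IsNestedIntervals q.1 q.2 CL CH ∧
          CL ⊆ B iL ∧ CH ⊆ B iH

/-- Incentive compatibility: `A_i ⊆ B_i ∪ ... ∪ B_{n-1}` for every `i`. -/
def IsIncentiveCompatible (B : Fin n → Set I) : Prop :=
  ∀ i, E.A i ⊆ ⋃ j, ⋃ _ : i ≤ j, (fun ω : I => (ω : ℝ)) '' B j

end Environment

end

/-! Write `level x` for the highest action optimal at `x`; sublevel and superlevel sets of `level`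
are cut out by the cutoffs.

Existence. If a solution puts mass on means below `γ_i`, then among the means recommending `a_i` it
charges only `γ_i` itself: otherwise the means strictly above `γ_i` could be merged with a small
fraction of the mass below, raising the payoff of that fraction at no cost
(`measure_level_eq_zero`). Hence every action above the lowest one used belongs to at most one cell,
whose mean is the cutoff. Cells of bi-pooling intervals can be nested: slide a window of fixed mass
along the interval and apply the intermediate value theorem to its first moment. The bound at the
left end is the mean-preserving contraction inequality, localised to the interval because the prior
and `G` integrate functions affine on each interval alike (`setIntegral_le_of_mem_MPC`,
`exists_Icc_mass_mean`).

Necessity. An equilibrium reaching the commitment payoff almost surely plays the best action at each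
induced mean. As any state can reveal itself, almost every state obtains at least its own level
(`level_le_ae`), so states pooled to a mean of level below `i` lie below `γ_i`. The equilibrium need
not use the canonical cells, but the law of the states pooled to `z_L` is dominated by the prior and
has the mass and mean of the interval `C_L`; such a measure cannot live strictly to the left of the
right end of `C_L` (`le_of_le_prior`). So `C_L` too ends below `γ_i`, and the states of the interval
above `γ_i` lie in `C_H`.

Sufficiency. Incentive compatibility says that almost every state of a cell recommends no more than
the mean of the cell. Let each state send its cell or reveal itself, whichever attains the higher
level `w ω`, and let any other message be attributed to one of its states with least `w`. No
deviation then pays (`IsPoolingSystem.isEquilibriumOutcome`); the work lies in measurability, which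
rests on `w` being upper semicontinuous. -/

/-! ### Integrability and integrated distribution functions. -/

lemma measurable_of_measurableSet_le {α : Type*} [MeasurableSpace α] {n : ℕ} {g : α → Fin n}
    (h : ∀ i, MeasurableSet {x | i ≤ g x}) : Measurable g := by
  refine measurable_to_countable' fun i => ?_
  have : g ⁻¹' {i} = {x | i ≤ g x} \ ⋃ k, ⋃ _ : i < k, {x | k ≤ g x} := by
    ext x
    simp only [mem_preimage, mem_singleton_iff, mem_sdiff, mem_ofPred_eq, mem_iUnion, not_exists,
      not_le]
    exact ⟨fun hx => ⟨hx.ge, fun k hk => hx ▸ hk⟩,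
      fun hx => le_antisymm (not_lt.mp fun hlt => lt_irrefl _ (hx.2 _ hlt)) hx.1⟩
  rw [this]
  exact (h i).diff (.iUnion fun k => .iUnion fun _ => h k)

lemma integrable_of_mem_Icc {α : Type*} [MeasurableSpace α] {μ : Measure α} [IsFiniteMeasure μ]
    {g : α → ℝ} (hg : Measurable g) {a b : ℝ} (h : ∀ x, g x ∈ Icc a b) : Integrable g μ :=
  .of_mem_Icc a b hg.aemeasurable (.of_forall h)

lemma integrable_coe_unitInterval (μ : Measure I) [IsFiniteMeasure μ] :
    Integrable (fun x : I => (x : ℝ)) μ :=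
  integrable_of_mem_Icc measurable_subtype_coe fun x => x.2

lemma integrable_posPart_sub (μ : Measure I) [IsFiniteMeasure μ] (c : I) :
    Integrable (fun t : I => max ((c : ℝ) - t) 0) μ :=
  integrable_of_mem_Icc (a := 0) (b := 1) (by fun_prop) fun t =>
    ⟨le_max_right _ _, max_le (by linarith [t.2.1, c.2.2]) zero_le_one⟩

/-- The integrated distribution function is the integral of the call payoff. -/
lemma setIntegral_Iic_real_Iic (G : Measure I) [IsFiniteMeasure G] (x : I) :
    ∫ s in Iic x, G.real (Iic s) = ∫ t, max ((x : ℝ) - t) 0 ∂G := by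
  have hmeas : MeasurableSet {p : I × I | p.2 ≤ p.1} := measurableSet_le measurable_snd measurable_fst
  have h1 : ∀ s : I, G.real (Iic s) = ∫ t, ({p : I × I | p.2 ≤ p.1}.indicator 1 (s, t) : ℝ) ∂G := by
    intro s
    have : (fun t => ({p : I × I | p.2 ≤ p.1}.indicator 1 (s, t) : ℝ)) = (Iic s).indicator 1 := by
      ext t; simp [indicator]
    rw [this, integral_indicator_one measurableSet_Iic]
  simp_rw [h1]
  rw [integral_integral_swap]
  · refine integral_congr_ae (.of_forall fun t => ?_)
    have : (fun s => ({p : I × I | p.2 ≤ p.1}.indicator 1 (s, t) : ℝ)) = (Ici t).indicator 1 := by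
      ext s; simp [indicator]
    simp only [this]
    rw [integral_indicator_one measurableSet_Ici, measureReal_restrict_apply measurableSet_Ici,
      Ici_inter_Iic, measureReal_def, unitInterval.volume_Icc, ENNReal.toReal_ofReal']
  · exact (integrable_of_mem_Icc (a := 0) (b := 1) (measurable_one.indicator hmeas) fun p => by
      change {p : I × I | p.2 ≤ p.1}.indicator (1 : I × I → ℝ) p ∈ Icc (0 : ℝ) 1
      by_cases h : p.2 ≤ p.1 <;> simp [indicator, h])

/-! ### The highest optimal action, the prior, and mean-preserving contractions. -/

namespace Environment

variable {n : ℕ} (E : Environment n)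

lemma pos {n : ℕ} (E : Environment n) : 0 < n := by
  rcases Nat.eq_zero_or_pos n with rfl | h
  · exact absurd (E.γ_zero.symm.trans E.γ_last) zero_ne_one
  · exact h

lemma exists_level (x : I) : ∃ i : Fin n, ∀ k : Fin n, k ≤ i ↔ E.γ k.castSucc ≤ x := by
  classical
  let s : Finset (Fin n) := Finset.univ.filter fun k => E.γ k.castSucc ≤ x
  have hs : s.Nonempty := ⟨⟨0, E.pos⟩, by
    have : (⟨0, E.pos⟩ : Fin n).castSucc = 0 := rfl
    simp only [s, Finset.mem_filter, Finset.mem_univ, true_and, this, E.γ_zero]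
    exact x.2.1⟩
  refine ⟨s.max' hs, fun k => ⟨fun hk => ?_, fun hk => s.le_max' _ (by simpa [s] using hk)⟩⟩
  have := s.max'_mem hs
  simp only [s, Finset.mem_filter, Finset.mem_univ, true_and] at this
  exact (E.γ_mono (Fin.castSucc_le_castSucc_iff.mpr hk)).trans this

/-- The highest action that is optimal at the posterior mean `x`. -/
noncomputable def level (x : I) : Fin n := (E.exists_level x).choose

lemma le_level_iff {x : I} {k : Fin n} : k ≤ E.level x ↔ E.γ k.castSucc ≤ x :=
  (E.exists_level x).choose_spec k

lemma γ_level_le (x : I) : E.γ (E.level x).castSucc ≤ x := E.le_level_iff.mp le_rfl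

lemma level_mono : Monotone E.level := fun x _ hxy =>
  E.le_level_iff.mpr ((E.γ_level_le x).trans hxy)

lemma measurable_level : Measurable E.level :=
  measurable_of_measurableSet_le fun i => by
    simp only [le_level_iff]
    exact measurableSet_le measurable_const measurable_subtype_coe

lemma mem_A_level (x : I) : (x : ℝ) ∈ E.A (E.level x) := by
  refine ⟨E.γ_level_le x, ?_⟩
  by_cases h : (E.level x : ℕ) + 1 < n
  · let k : Fin n := ⟨E.level x + 1, h⟩
    have hk : k.castSucc = (E.level x).succ := rfl
    have : ¬ k ≤ E.level x := by
      rw [Fin.le_def]; simp [k]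
    rw [le_level_iff, hk, not_le] at this
    exact this.le
  · have : (E.level x).succ = Fin.last n := by
      apply Fin.ext; simp only [Fin.val_succ, Fin.val_last]
      have := (E.level x).2; omega
    rw [this, E.γ_last]; exact x.2.2

lemma le_level_of_mem_A {x : I} {k : Fin n} (h : (x : ℝ) ∈ E.A k) : k ≤ E.level x :=
  E.le_level_iff.mpr h.1

lemma recommends_iff {x : I} {i : Fin n} : E.Recommends x i ↔ i = E.level x :=
  ⟨fun h => le_antisymm (E.le_level_of_mem_A h.1) (h.2 _ (E.mem_A_level x)),
    fun h => h ▸ ⟨E.mem_A_level x, fun _ => E.le_level_of_mem_A⟩⟩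

lemma value_eq (x : I) : E.value x = E.v (E.level x) := by
  have : Nonempty {i : Fin n // (x : ℝ) ∈ E.A i} := ⟨⟨_, E.mem_A_level x⟩⟩
  refine le_antisymm (ciSup_le fun i => E.v_strictMono.monotone (E.le_level_of_mem_A i.2)) ?_
  exact le_ciSup (f := fun i : {i : Fin n // (x : ℝ) ∈ E.A i} => E.v i)
    (Set.finite_range _).bddAbove ⟨_, E.mem_A_level x⟩

lemma integrable_v {α : Type*} [MeasurableSpace α] (μ : Measure α) [IsFiniteMeasure μ]
    {g : α → Fin n} (hg : Measurable g) : Integrable (fun x => E.v (g x)) μ :=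
  integrable_of_mem_Icc (a := E.v ⟨0, E.pos⟩) (b := E.v ⟨n - 1, Nat.sub_lt E.pos one_pos⟩)
    ((measurable_of_countable E.v).comp hg) fun x =>
    ⟨E.v_strictMono.monotone (Fin.le_def.mpr (Nat.zero_le _)),
      E.v_strictMono.monotone (Fin.le_def.mpr (Nat.le_sub_one_of_lt (g x).2))⟩

lemma designPayoff_eq (G : Measure I) : E.designPayoff G = ∫ x, E.v (E.level x) ∂G := by
  simp_rw [designPayoff, value_eq]

instance : IsProbabilityMeasure E.prior :=
  ⟨by rw [prior, withDensity_apply _ .univ, Measure.restrict_univ, E.lintegral_f]⟩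

lemma prior_absolutelyContinuous : E.prior ≪ volume := withDensity_absolutelyContinuous _ _

lemma volume_absolutelyContinuous : (volume : Measure I) ≪ E.prior :=
  withDensity_absolutelyContinuous' E.measurable_f.coe_nnreal_ennreal.aemeasurable
    (.of_forall fun ω => by simpa using (E.f_pos ω).ne')

instance : NullSingletonClass E.prior :=
  ⟨fun x => E.prior_absolutelyContinuous (measure_singleton x)⟩

lemma prior_pos_of_Ioo_subset {a b : I} (hab : a < b) {s : Set I} (hs : Ioo a b ⊆ s) :
    0 < E.prior s := by
  refine pos_iff_ne_zero.mpr fun h => ?_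
  have := E.volume_absolutelyContinuous (measure_mono_null hs h)
  rw [unitInterval.volume_Ioo, ENNReal.ofReal_eq_zero] at this
  have : (a : ℝ) < b := hab
  linarith

/-- A closed set that contains almost every state of `[c, 1]` contains `[c, 1]`. -/
lemma Ici_subset_of_ae {c : ℝ} (hc : c < 1) {U : Set I} (hU : IsClosed U)
    (h : ∀ᵐ ω : I ∂E.prior, c < ω → ω ∈ U) {ω : I} (hω : c ≤ ω) : ω ∈ U := by
  by_contra hmem
  obtain ⟨ε, hε, hball⟩ := Metric.isOpen_iff.mp hU.isOpen_compl ω hmem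
  have key : ∀ a b : I, a < b → Ioo a b ⊆ Metric.ball ω ε → (∀ t ∈ Ioo a b, c < (t : ℝ)) → False := by
    intro a b hab hsub hlt
    refine (E.prior_pos_of_Ioo_subset hab subset_rfl).ne' (measure_mono_null ?_ h)
    exact fun t ht hh => hball (hsub ht) (hh (hlt t ht))
  -- An interval just to the right of `ω` lies above `c`. Only `ω = 1` forces a move to the left,
  -- and there `c < 1` leaves room.
  rcases lt_or_eq_of_le ω.2.2 with h1 | h1
  · let b : I := ⟨min 1 (ω + ε), le_min zero_le_one (by linarith [ω.2.1]), min_le_left _ _⟩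
    refine key ω b (Subtype.coe_lt_coe.mp (lt_min h1 (by linarith))) ?_ fun t ht =>
      hω.trans_lt (Subtype.coe_lt_coe.mpr ht.1)
    intro t ht
    have h2 : (ω : ℝ) < t := ht.1
    have h3 : (t : ℝ) < min 1 (ω + ε) := ht.2
    rw [Metric.mem_ball, Subtype.dist_eq, Real.dist_eq, abs_lt]
    constructor <;> linarith [min_le_right 1 ((ω : ℝ) + ε)]
  · have hm : max (max 0 c) (ω - ε) < (ω : ℝ) :=
      max_lt (max_lt (by rw [h1]; exact one_pos) (h1 ▸ hc)) (by linarith)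
    let a : I := ⟨max (max 0 c) (ω - ε), le_max_of_le_left (le_max_left _ _), hm.le.trans ω.2.2⟩
    have ha : ∀ t : I, a < t → max (max 0 c) (ω - ε) < (t : ℝ) := fun t ht => ht
    refine key a ω (Subtype.coe_lt_coe.mp hm) ?_ fun t ht => ?_
    · intro t ht
      have h2 := ha t ht.1
      have h3 : (t : ℝ) < ω := ht.2
      rw [Metric.mem_ball, Subtype.dist_eq, Real.dist_eq, abs_lt]
      constructor <;> linarith [le_max_right (max 0 c) ((ω : ℝ) - ε)]
    · exact ((le_max_right 0 c).trans (le_max_left _ _)).trans_lt (ha t ht.1)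

/-- The integrated distribution function at `x` is the integral of `max (x - t) 0`. At `x = 1` this
is one minus the mean, so equality there is equality of means. -/
lemma mem_MPC_iff {G : Measure I} [IsProbabilityMeasure G] : G ∈ E.MPC ↔
    (∀ x : I, ∫ t, max ((x : ℝ) - t) 0 ∂G ≤ ∫ t, max ((x : ℝ) - t) 0 ∂E.prior) ∧
      ∫ t : I, (t : ℝ) ∂G = ∫ t : I, (t : ℝ) ∂E.prior := by
  have h1 : ∀ μ : Measure I, IsProbabilityMeasure μ →
      ∫ t : I, max (((1 : I) : ℝ) - t) 0 ∂μ = 1 - ∫ t : I, (t : ℝ) ∂μ := by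
    intro μ _
    have : ∀ t : I, max (((1 : I) : ℝ) - t) 0 = 1 - t := fun t =>
      max_eq_left (by simpa using t.2.2)
    simp_rw [this]
    rw [integral_sub (integrable_const _) (integrable_coe_unitInterval μ)]; simp
  simp only [MPC, mem_ofPred_eq, setIntegral_Iic_real_Iic]
  rw [h1 G inferInstance, h1 E.prior inferInstance]
  exact ⟨fun h => ⟨h.2.1, by linarith [h.2.2]⟩, fun h => ⟨inferInstance, h.1, by linarith [h.2]⟩⟩

end Environment

/-! ### Merging posterior means, and what optimality excludes. -/

lemma integral_add_smul_dirac {G' ρ : Measure I} [IsFiniteMeasure G'] [IsFiniteMeasure ρ] (m : I)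
    {g : I → ℝ} (hg : Integrable g G') :
    ∫ t, g t ∂(G' + ρ univ • Measure.dirac m) = ∫ t, g t ∂G' + ρ.real univ * g m := by
  rw [integral_add_measure hg ((integrable_dirac (by simp)).smul_measure (measure_ne_top _ _)),
    integral_smul_measure, integral_dirac, smul_eq_mul, measureReal_def]

namespace Environment

variable {n : ℕ} (E : Environment n)

/-- Jensen's inequality for the convex functions `max (x - t) 0`: collapsing a part of the
distribution to its barycentre is a further contraction. -/
lemma add_smul_dirac_mem_MPC {G' ρ : Measure I} [IsFiniteMeasure G'] [IsFiniteMeasure ρ]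
    (h : G' + ρ ∈ E.MPC) (m : I) (hm : ρ.real univ * m = ∫ t : I, (t : ℝ) ∂ρ) :
    G' + ρ univ • Measure.dirac m ∈ E.MPC := by
  have := h.1
  have : IsProbabilityMeasure (G' + ρ univ • Measure.dirac m) :=
    ⟨by
    rw [Measure.add_apply, Measure.smul_apply, measure_univ (μ := Measure.dirac m), smul_eq_mul,
      mul_one, ← Measure.add_apply]
    exact h.1.measure_univ⟩
  rw [mem_MPC_iff] at h ⊢
  refine ⟨fun x => le_trans ?_ (h.1 x), ?_⟩
  · rw [integral_add_smul_dirac m (integrable_posPart_sub G' x),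
      integral_add_measure (integrable_posPart_sub G' x) (integrable_posPart_sub ρ x)]
    gcongr
    rw [mul_max_of_nonneg _ _ measureReal_nonneg, mul_zero]
    refine max_le ?_ (integral_nonneg fun t => le_max_right _ _)
    rw [mul_sub, hm]
    have : ρ.real univ * x - ∫ t : I, (t : ℝ) ∂ρ = ∫ t : I, ((x : ℝ) - t) ∂ρ := by
      rw [integral_sub (integrable_const _) (integrable_coe_unitInterval ρ)]; simp
    rw [this]
    exact integral_mono ((integrable_const _).sub (integrable_coe_unitInterval ρ))
      (integrable_posPart_sub ρ x) fun t => le_max_left _ _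
  · rw [← h.2, integral_add_smul_dirac m (integrable_coe_unitInterval G'), hm,
      integral_add_measure (integrable_coe_unitInterval G') (integrable_coe_unitInterval ρ)]

lemma mean_mem_unitInterval (ρ : Measure I) [IsFiniteMeasure ρ] :
    ∃ m : I, ρ.real univ * m = ∫ t : I, (t : ℝ) ∂ρ := by
  rcases eq_or_ne (ρ.real univ) 0 with h | h
  · refine ⟨0, ?_⟩
    have : ρ = 0 := Measure.measure_univ_eq_zero.mp ((measureReal_eq_zero_iff).mp h)
    simp [this]
  · have hpos : 0 < ρ.real univ := lt_of_le_of_ne measureReal_nonneg h.symm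
    refine ⟨⟨(∫ t : I, (t : ℝ) ∂ρ) / ρ.real univ,
      div_nonneg (integral_nonneg fun t => t.2.1) hpos.le, (div_le_one hpos).mpr ?_⟩, ?_⟩
    · calc ∫ t : I, (t : ℝ) ∂ρ ≤ ∫ _ : I, (1 : ℝ) ∂ρ :=
            integral_mono (integrable_coe_unitInterval ρ) (integrable_const _) fun t => t.2.2
        _ = ρ.real univ := by simp
    · exact mul_div_cancel₀ _ h

/-- If a solution of the design problem recommends actions below `a_i` with positive probability,
then it recommends `a_i` only at the lowest posterior mean at which `a_i` is optimal. -/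
lemma IsOptimal.measure_level_eq_zero {G : Measure I} (hG : E.IsOptimal G) {i : Fin n}
    (hlow : G {x : I | (x : ℝ) < E.γ i.castSucc} ≠ 0) :
    G {x : I | E.γ i.castSucc < x ∧ E.level x = i} = 0 := by
  by_contra hD
  have := hG.1.1
  set g : ℝ := E.γ i.castSucc with hg
  set L : Set I := {x : I | (x : ℝ) < g} with hL
  set D : Set I := {x : I | g < x ∧ E.level x = i} with hDdef
  have hLm : MeasurableSet L := measurableSet_lt measurable_subtype_coe measurable_const
  have hDm : MeasurableSet D := (measurableSet_lt measurable_const measurable_subtype_coe).inter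
    (E.measurable_level (measurableSet_singleton i))
  have hDL : Disjoint L D := disjoint_left.mpr fun x hx hx' => lt_asymm hx hx'.1
  have hintD : 0 < ∫ x in D, ((x : ℝ) - g) ∂G := by
    rw [setIntegral_pos_iff_support_of_nonneg_ae]
    · refine (pos_iff_ne_zero.mpr hD).trans_le (measure_mono fun x hx => ⟨?_, hx⟩)
      exact (sub_pos.mpr hx.1).ne'
    · exact (ae_restrict_mem hDm).mono fun x hx => (sub_pos.mpr hx.1).le
    · exact ((integrable_coe_unitInterval G).sub (integrable_const _)).integrableOn
  have hintL : 0 ≤ ∫ x in L, (g - (x : ℝ)) ∂G :=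
    setIntegral_nonneg hLm fun x hx => (sub_pos.mpr hx).le
  -- The fraction `ε` of `L` is small enough that adding it to `D` leaves the mean at or above `g`.
  -- The denominator `P + 1` is positive without knowing `P > 0`.
  obtain ⟨ε, hε0, hε1, hε⟩ : ∃ ε : ℝ≥0, 0 < ε ∧ ε ≤ 1 ∧
      ε * ∫ x in L, (g - (x : ℝ)) ∂G ≤ ∫ x in D, ((x : ℝ) - g) ∂G := by
    set P := ∫ x in L, (g - (x : ℝ)) ∂G
    set R := ∫ x in D, ((x : ℝ) - g) ∂G
    refine ⟨⟨min 1 (R / (P + 1)), by positivity⟩, ?_, ?_, ?_⟩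
    · exact NNReal.coe_pos.mp (lt_min one_pos (by positivity))
    · exact NNReal.coe_le_coe.mp (min_le_left _ _)
    · change min 1 (R / (P + 1)) * P ≤ R
      calc min 1 (R / (P + 1)) * P ≤ R / (P + 1) * (P + 1) :=
            mul_le_mul (min_le_right _ _) (by linarith) hintL (by positivity)
        _ = R := div_mul_cancel₀ _ (by positivity)
  set G' : Measure I := G.restrict (L ∪ D)ᶜ + (1 - ε) • G.restrict L with hG'
  set ρ : Measure I := ε • G.restrict L + G.restrict D with hρ
  have hsum : G' + ρ = G := by
    have h1 : G.restrict (L ∪ D)ᶜ + G.restrict (L ∪ D) = G := Measure.restrict_compl_add_restrict (hLm.union hDm)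
    rw [Measure.restrict_union hDL hDm] at h1
    have h2 : (1 - ε) • G.restrict L + ε • G.restrict L = G.restrict L := by
      rw [← add_smul, tsub_add_cancel_of_le hε1, one_smul]
    calc G' + ρ = G.restrict (L ∪ D)ᶜ + (((1 - ε) • G.restrict L + ε • G.restrict L)
          + G.restrict D) := by rw [hG', hρ]; abel
      _ = G := by rw [h2, h1]
  obtain ⟨m, hm⟩ := mean_mem_unitInterval ρ
  have hρint : ∀ φ : I → ℝ, Integrable φ G →
      ∫ x, φ x ∂ρ = ε * ∫ x in L, φ x ∂G + ∫ x in D, φ x ∂G := by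
    intro φ hφ
    rw [hρ, integral_add_measure (hφ.restrict.smul_measure_nnreal) hφ.restrict,
      integral_smul_nnreal_measure]
    rfl
  have hρpos : 0 < ρ.real univ := by
    rw [measureReal_def]
    refine ENNReal.toReal_pos ?_ (measure_ne_top _ _)
    simp [hρ, hD]
  have hgm : g ≤ m := by
    have h1 : ∫ x : I, ((x : ℝ) - g) ∂ρ = ρ.real univ * (m - g) := by
      rw [integral_sub (integrable_coe_unitInterval ρ) (integrable_const _), mul_sub, hm]; simp
    rw [hρint (fun x => (x : ℝ) - g) ((integrable_coe_unitInterval G).sub (integrable_const _))] at h1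
    have h2 : ∫ x in L, ((x : ℝ) - g) ∂G = - ∫ x in L, (g - (x : ℝ)) ∂G := by
      rw [← integral_neg]; simp
    rw [h2] at h1
    have h3 : 0 ≤ ρ.real univ * (m - g) := by rw [← h1]; linarith
    linarith [nonneg_of_mul_nonneg_right h3 hρpos]
  have hH := hG.2 _ (E.add_smul_dirac_mem_MPC (hsum ▸ hG.1) m hm)
  have hu : ∀ μ : Measure I, IsFiniteMeasure μ → Integrable (fun x => E.v (E.level x)) μ :=
    fun μ _ => E.integrable_v μ E.measurable_level
  rw [designPayoff_eq, designPayoff_eq, integral_add_smul_dirac m (hu _ inferInstance)] at hH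
  have hGint : ∫ x, E.v (E.level x) ∂G = ∫ x, E.v (E.level x) ∂G' + ∫ x, E.v (E.level x) ∂ρ := by
    rw [← integral_add_measure (hu _ inferInstance) (hu _ inferInstance), hsum]
  have hlt : ∫ x, E.v (E.level x) ∂ρ < ∫ _, E.v i ∂ρ := by
    rw [← sub_pos, ← integral_sub (integrable_const _) (hu _ inferInstance),
      hρint (fun x => E.v i - E.v (E.level x)) ((integrable_const _).sub (hu _ inferInstance))]
    have h1 : ∫ x in D, (E.v i - E.v (E.level x)) ∂G = 0 := by
      rw [setIntegral_congr_fun hDm (g := fun _ => (0 : ℝ)) fun x hx => by simp [hx.2]]; simp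
    have hlow' : ∀ x ∈ L, 0 < E.v i - E.v (E.level x) := fun x hx => by
      refine sub_pos.mpr (E.v_strictMono (not_le.mp fun h => ?_))
      exact (E.le_level_iff.mp h).not_gt hx
    rw [h1, add_zero]
    refine mul_pos (NNReal.coe_pos.mpr hε0) ?_
    rw [setIntegral_pos_iff_support_of_nonneg_ae]
    · exact (pos_iff_ne_zero.mpr hlow).trans_le (measure_mono fun x hx => ⟨(hlow' x hx).ne', hx⟩)
    · exact (ae_restrict_mem hLm).mono fun x hx => (hlow' x hx).le
    · exact ((integrable_const _).sub (hu _ inferInstance)).integrableOn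
  have hvm : E.v i ≤ E.v (E.level m) := E.v_strictMono.monotone (E.le_level_iff.mpr hgm)
  have : ∫ _, E.v i ∂ρ ≤ ρ.real univ * E.v (E.level m) := by
    simpa using mul_le_mul_of_nonneg_left hvm hρpos.le
  linarith

end Environment

/-! ### Bi-pooling intervals and their cells. -/

/-- The posterior means that `G` induces within the interval `q`. -/
abbrev signals (G : Measure I) (q : I × I) : Set I := (G.restrict (Ioo q.1 q.2)).support

namespace Environment

variable {n : ℕ} (E : Environment n)

/-- Among the measures below the prior with the same mass and the same mean as the prior on an
interval, none is concentrated on the states below a point to the left of the upper end. -/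
lemma le_of_le_prior {μ : Measure I} (hle : μ ≤ E.prior) {x y : I} (hxy : x < y)
    (hmass : μ.real univ = E.prior.real (Icc x y))
    (hmean : ∫ t : I, (t : ℝ) ∂μ = ∫ t in Icc x y, (t : ℝ) ∂E.prior)
    {c : ℝ} (hc : μ {t : I | c < t} = 0) : y ≤ c := by
  by_contra! hcy
  have : IsFiniteMeasure μ := isFiniteMeasure_of_le _ hle
  -- `h` changes sign at `x`, so a measure below the prior and carried by `{t ≤ c}` gives it at most
  -- its prior integral over `[x, c]`. That is strictly less than the integral over `[x, y]`,
  -- whereas equal mass and mean would force equality.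
  set h : I → ℝ := fun t => (t : ℝ) - x with hdef
  have hint : ∀ ν : Measure I, IsFiniteMeasure ν → Integrable h ν := fun ν _ =>
    (integrable_coe_unitInterval ν).sub (integrable_const _)
  have heq : ∫ t, h t ∂μ = ∫ t in Icc x y, h t ∂E.prior := by
    simp only [hdef]
    rw [integral_sub (integrable_coe_unitInterval _) (integrable_const _),
      integral_sub (integrable_coe_unitInterval _) (integrable_const _), hmean]
    simp [hmass]
  set C : Set I := {t : I | (t : ℝ) ≤ c} with hC
  have hCm : MeasurableSet C := measurableSet_le measurable_subtype_coe measurable_const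
  have hCc : Cᶜ = {t : I | c < t} := by ext t; simp [hC]
  have hset : Icc x y ∩ C = Ici x ∩ C := by
    ext t
    simp only [hC, mem_inter_iff, mem_Icc, mem_ofPred_eq, mem_Ici]
    exact ⟨fun ht => ⟨ht.1.1, ht.2⟩,
      fun ht => ⟨⟨ht.1, Subtype.coe_le_coe.mp (ht.2.trans hcy.le)⟩, ht.2⟩⟩
  have h1 : ∫ t, h t ∂μ ≤ ∫ t in Ici x ∩ C, h t ∂E.prior := by
    calc ∫ t, h t ∂μ = ∫ t in C, h t ∂μ := by
          rw [Measure.restrict_eq_self_of_ae_mem]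
          rw [ae_iff]; exact hc ▸ congrArg μ hCc
      _ = ∫ t in C ∩ Ici x, h t ∂μ + ∫ t in C \ Ici x, h t ∂μ :=
          (integral_inter_add_sdiff measurableSet_Ici (hint _ inferInstance).integrableOn).symm
      _ ≤ ∫ t in C ∩ Ici x, h t ∂μ + 0 := by
          gcongr
          refine setIntegral_nonpos (hCm.diff measurableSet_Ici) fun t ht => ?_
          have : (t : ℝ) < x := not_le.mp ht.2
          simp only [hdef]; linarith
      _ = ∫ t in Ici x ∩ C, h t ∂μ := by rw [add_zero, inter_comm]
      _ ≤ ∫ t in Ici x ∩ C, h t ∂E.prior := by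
          refine integral_mono_measure (Measure.restrict_mono subset_rfl hle) ?_
            (hint _ inferInstance)
          exact (ae_restrict_mem (measurableSet_Ici.inter hCm)).mono fun t ht =>
            sub_nonneg.mpr ht.1
  have h2 : 0 < ∫ t in Icc x y \ C, h t ∂E.prior := by
    have hpos : ∀ t ∈ Icc x y \ C, 0 ≤ h t := fun t ht => sub_nonneg.mpr ht.1.1
    rw [setIntegral_pos_iff_support_of_nonneg_ae
      ((ae_restrict_mem (measurableSet_Icc.diff hCm)).mono hpos) (hint _ inferInstance).integrableOn]
    let a : I := ⟨max x c, le_max_of_le_left x.2.1, max_le x.2.2 (hcy.le.trans y.2.2)⟩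
    have hay : a < y := Subtype.coe_lt_coe.mp (max_lt (Subtype.coe_lt_coe.mpr hxy) hcy)
    refine E.prior_pos_of_Ioo_subset hay fun t ht => ?_
    have h3 : max (x : ℝ) c < t := ht.1
    have h4 := max_lt_iff.mp h3
    refine ⟨?_, ⟨Subtype.coe_le_coe.mp h4.1.le, ht.2.le⟩, not_le.mpr h4.2⟩
    exact (sub_pos.mpr h4.1).ne'
  have h3 := integral_inter_add_sdiff (μ := E.prior) (f := h) (s := Icc x y) hCm
    (hint _ inferInstance).integrableOn
  rw [hset] at h3
  linarith

variable {E} {G : Measure I} {S : Set (I × I)}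

namespace IsBiPoolingFamily

variable {q : I × I}

lemma finite_signals (hS : E.IsBiPoolingFamily G S) (hq : q ∈ S) : (signals G q).Finite :=
  finite_of_encard_le_coe (k := 2) (hS.card_support q hq)

/-- The support is finite, so `z` has a neighbourhood meeting it in `z` alone; the positive mass of
that neighbourhood must sit at `z`. -/
lemma restrict_singleton_ne_zero (hS : E.IsBiPoolingFamily G S) (hq : q ∈ S) {z : I}
    (hz : z ∈ signals G q) : G.restrict (Ioo q.1 q.2) {z} ≠ 0 := by
  have hopen : IsOpen ((signals G q) \ {z})ᶜ :=
    ((hS.finite_signals hq).subset sdiff_subset).isClosed.isOpen_compl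
  have h := Measure.mem_support_iff_forall z |>.mp hz _ (hopen.mem_nhds (by simp))
  refine (h.trans_le ?_).ne'
  calc G.restrict (Ioo q.1 q.2) ((signals G q) \ {z})ᶜ
      ≤ G.restrict (Ioo q.1 q.2) ({z} ∪ (signals G q)ᶜ) := measure_mono fun t ht => by
        by_cases h : t = z
        · exact Or.inl h
        · exact Or.inr fun h' => ht ⟨h', h⟩
    _ ≤ G.restrict (Ioo q.1 q.2) {z} + G.restrict (Ioo q.1 q.2) (signals G q)ᶜ :=
        measure_union_le _ _
    _ = G.restrict (Ioo q.1 q.2) {z} := by rw [Measure.measure_compl_support, add_zero]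

lemma signals_subset (hS : E.IsBiPoolingFamily G S) (hq : q ∈ S) :
    signals G q ⊆ Ioo q.1 q.2 := by
  intro z hz
  by_contra h
  apply hS.restrict_singleton_ne_zero hq hz
  rw [Measure.restrict_apply (measurableSet_singleton z), singleton_inter_eq_empty.mpr h,
    measure_empty]

lemma measure_singleton_ne_zero (hS : E.IsBiPoolingFamily G S) (hq : q ∈ S) {z : I}
    (hz : z ∈ signals G q) : G {z} ≠ 0 := by
  have := hS.restrict_singleton_ne_zero hq hz
  rwa [Measure.restrict_apply (measurableSet_singleton z),
    inter_eq_left.mpr (singleton_subset_iff.mpr (hS.signals_subset hq hz))] at this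

lemma restrict_Ioo (hS : E.IsBiPoolingFamily G S) (hq : q ∈ S) :
    G.restrict (Ioo q.1 q.2) = G.restrict (signals G q) := by
  have h1 : (G.restrict (Ioo q.1 q.2)).restrict (signals G q) = G.restrict (Ioo q.1 q.2) :=
    Measure.restrict_eq_self_of_ae_mem Measure.support_mem_ae
  rw [← h1, Measure.restrict_restrict (hS.finite_signals hq).measurableSet,
    inter_eq_left.mpr (hS.signals_subset hq)]

lemma measure_signals (hS : E.IsBiPoolingFamily G S) (hq : q ∈ S) :
    G (signals G q) = E.prior (Icc q.1 q.2) := by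
  have h := congrArg (fun μ => μ univ) (hS.restrict_Ioo hq)
  simp only [Measure.restrict_apply_univ] at h
  rw [← h, hS.mass q hq, measure_congr Ioo_ae_eq_Icc]

lemma setIntegral_signals (hS : E.IsBiPoolingFamily G S) (hq : q ∈ S) :
    ∫ x in signals G q, (x : ℝ) ∂G = ∫ x in Icc q.1 q.2, (x : ℝ) ∂E.prior := by
  rw [← hS.restrict_Ioo hq, hS.mean q hq]
  exact setIntegral_congr_set Ioo_ae_eq_Icc

lemma signals_eq (hS : E.IsBiPoolingFamily G S) (hq : q ∈ S) :
    (∃ z, signals G q = {z}) ∨ ∃ zL zH, zL < zH ∧ signals G q = {zL, zH} := by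
  have hne : (signals G q).Nonempty := by
    rw [nonempty_iff_ne_empty]
    intro h
    have := hS.measure_signals hq
    rw [h, measure_empty] at this
    exact (E.prior_pos_of_Ioo_subset (hS.lt q hq) Ioo_subset_Icc_self).ne this
  rcases (hS.card_support q hq).lt_or_eq with h | h
  · refine .inl (encard_eq_one.mp (le_antisymm ?_ (one_le_encard_iff_nonempty.mpr hne)))
    exact Order.le_of_lt_add_one (h.trans_eq (by norm_num))
  · obtain ⟨x, y, hxy, hs⟩ := encard_eq_two.mp h
    rcases lt_or_gt_of_ne hxy with h | h
    · exact .inr ⟨x, y, h, hs⟩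
    · exact .inr ⟨y, x, h, hs.trans (pair_comm _ _)⟩

lemma eq_of_mem (hS : E.IsBiPoolingFamily G S) {q' : I × I} (hq : q ∈ S) (hq' : q' ∈ S) {z : I}
    (hz : z ∈ Ioo q.1 q.2) (hz' : z ∈ Ioo q'.1 q'.2) : q = q' :=
  hS.disjoint.elim hq hq' (not_disjoint_iff.mpr ⟨z, hz, hz'⟩)

lemma countable (hS : E.IsBiPoolingFamily G S) : S.Countable :=
  hS.disjoint.countable_of_isOpen (fun _ _ => isOpen_Ioo) fun q hq => nonempty_Ioo.mpr (hS.lt q hq)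

end IsBiPoolingFamily

lemma setIntegral_singleton_coe (G : Measure I) (z : I) :
    ∫ x in {z}, (x : ℝ) ∂G = z * G.real {z} := by
  rw [integral_singleton, smul_eq_mul, mul_comm]

lemma setIntegral_pair_coe (G : Measure I) [IsFiniteMeasure G] {z z' : I} (h : z ≠ z') :
    ∫ x in {z, z'}, (x : ℝ) ∂G = z * G.real {z} + z' * G.real {z'} := by
  rw [insert_eq, setIntegral_union (by simpa using h) (measurableSet_singleton z')
    (integrable_coe_unitInterval G).integrableOn (integrable_coe_unitInterval G).integrableOn,
    setIntegral_singleton_coe, setIntegral_singleton_coe]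

lemma condMean_eq_iff {B : Set I} (hB : E.prior.real B ≠ 0) {z : ℝ} :
    E.condMean B = z ↔ ∫ ω in B, (ω : ℝ) ∂E.prior = z * E.prior.real B := by
  rw [condMean, setAverage_eq, smul_eq_mul, inv_mul_eq_iff_eq_mul₀ hB, mul_comm]

lemma le_condMean_iff {B : Set I} (hB : E.prior.real B ≠ 0) {z : ℝ} :
    z ≤ E.condMean B ↔ z * E.prior.real B ≤ ∫ ω in B, (ω : ℝ) ∂E.prior := by
  have : 0 < E.prior.real B := lt_of_le_of_ne measureReal_nonneg hB.symm
  rw [condMean, setAverage_eq, smul_eq_mul, inv_mul_eq_div, le_div_iff₀ this]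

/-- `T` assigns to every posterior mean `z` that `G` induces within the interval `q` a cell of
states; these cells partition the interval. -/
structure IsCellFamily (E : Environment n) (G : Measure I) (q : I × I) (T : I → Set I) : Prop where
  closed : ∀ z ∈ signals G q, IsClosed (T z)
  union : ⋃ z ∈ signals G q, T z = Icc q.1 q.2
  null_inter : ∀ z ∈ signals G q, ∀ z' ∈ signals G q, z ≠ z' → E.prior (T z ∩ T z') = 0
  mass : ∀ z ∈ signals G q, E.prior (T z) = G {z}
  mean : ∀ z ∈ signals G q, ∫ ω in T z, (ω : ℝ) ∂E.prior = z * G.real {z}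

lemma IsBiPoolingFamily.isCellFamily_pooling (hS : E.IsBiPoolingFamily G S) {q : I × I}
    (hq : q ∈ S) {z : I} (hz : signals G q = {z}) :
    E.IsCellFamily G q fun _ => Icc q.1 q.2 where
  closed _ _ := isClosed_Icc
  union := by rw [hz]; simp
  null_inter := by
    rw [hz]; rintro x rfl y rfl h; exact absurd rfl h
  mass := by
    rw [hz]; rintro x rfl; rw [← hS.measure_signals hq, hz]
  mean := by
    rw [hz]; rintro x rfl
    rw [← hS.setIntegral_signals hq, hz, setIntegral_singleton_coe]

/-- A bi-partition prescribes only conditional means. Total mass and total first moment give two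
linear equations for the masses of the cells, with a unique solution because `zL ≠ zH`. -/
lemma IsBiPoolingFamily.isCellFamily_biPooling [IsFiniteMeasure G]
    (hS : E.IsBiPoolingFamily G S) {q : I × I}
    (hq : q ∈ S) {zL zH : I} (hlt : zL < zH) (hz : signals G q = {zL, zH}) {CL CH : Set I}
    (hC : E.IsBiPartition q.1 q.2 zL zH CL CH) :
    E.IsCellFamily G q fun z => if z = zL then CL else CH := by
  -- A null cell would have `condMean` equal to the default value `0`, but means inside an open
  -- interval are positive.
  have hpos : ∀ z ∈ signals G q, ∀ C, E.condMean C = z → E.prior.real C ≠ 0 := by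
    intro z hz C hC h
    have h0 : (0 : ℝ) < z := (q.1.2.1).trans_lt (hS.signals_subset hq hz).1
    rw [condMean, setAverage_eq, h] at hC
    simp at hC
    linarith
  have hL : zL ∈ signals G q := by simp [hz]
  have hH : zH ∈ signals G q := by simp [hz]
  have hmL := (condMean_eq_iff (hpos _ hL _ hC.mean_L)).mp hC.mean_L
  have hmH := (condMean_eq_iff (hpos _ hH _ hC.mean_H)).mp hC.mean_H
  have hd : AEDisjoint E.prior CL CH := hC.null_inter
  have hmass : E.prior.real CL + E.prior.real CH = G.real {zL} + G.real {zH} := by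
    rw [← measureReal_union₀ hC.closed_H.nullMeasurableSet hd, hC.union, measureReal_def,
      ← hS.measure_signals hq, hz, insert_eq, ← measureReal_def,
      measureReal_union (by simpa using hlt.ne) (measurableSet_singleton _)]
  have hint : zL * E.prior.real CL + zH * E.prior.real CH
      = zL * G.real {zL} + zH * G.real {zH} := by
    rw [← setIntegral_pair_coe G hlt.ne, ← hz, hS.setIntegral_signals hq, ← hC.union,
      setIntegral_union₀ hd hC.closed_H.nullMeasurableSet
        (integrable_coe_unitInterval _).integrableOn (integrable_coe_unitInterval _).integrableOn,
      hmL, hmH]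
  have hlt' : (zL : ℝ) < zH := hlt
  have eH : E.prior.real CH = G.real {zH} := by
    have : ((zH : ℝ) - zL) * (E.prior.real CH - G.real {zH}) = 0 := by linear_combination hint - zL * hmass
    rcases mul_eq_zero.mp this with h | h <;> linarith
  have eL : E.prior.real CL = G.real {zL} := by linarith
  have toENN : ∀ {C : Set I} {z : I}, E.prior.real C = G.real {z} → E.prior C = G {z} :=
    fun h => (measureReal_eq_measureReal_iff).mp h
  refine ⟨?_, ?_, ?_, ?_, ?_⟩ <;> rw [hz]
  · rintro z (rfl | rfl)
    · simpa using hC.closed_L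
    · simpa [hlt.ne'] using hC.closed_H
  · simp [hlt.ne', hC.union]
  · rintro z (rfl | rfl) z' (rfl | rfl) h
    · exact absurd rfl h
    · simpa [hlt.ne'] using hC.null_inter
    · simpa [hlt.ne', inter_comm] using hC.null_inter
    · exact absurd rfl h
  · rintro z (rfl | rfl)
    · simpa using toENN eL
    · simpa [hlt.ne'] using toENN eH
  · rintro z (rfl | rfl)
    · simpa [eL] using hmL
    · simpa [hlt.ne', eH] using hmH

end Environment

/-! ### Necessity: equilibria that attain the commitment payoff. -/

namespace Environment

variable {n : ℕ} {E : Environment n} {G : Measure I} {B : Fin n → Set I}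

lemma measurable_postMean (p : Kernel Message I) [IsMarkovKernel p] : Measurable (postMean p) :=
  (StronglyMeasurable.integral_kernel (κ := p)
    measurable_subtype_coe.stronglyMeasurable).measurable

lemma postMean_mem (p : Kernel Message I) [IsMarkovKernel p] (m : Message) :
    postMean p m ∈ I := by
  refine ⟨integral_nonneg fun ω => ω.2.1, ?_⟩
  calc postMean p m ≤ ∫ _ : I, (1 : ℝ) ∂(p m) :=
        integral_mono (integrable_coe_unitInterval _) (integrable_const _) fun t => t.2.2
    _ = 1 := by simp

/-- The posterior mean as a point of the state space. -/
noncomputable def postMeanI (p : Kernel Message I) [IsMarkovKernel p] (m : Message) : I :=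
  ⟨postMean p m, postMean_mem p m⟩

lemma coe_postMeanI (p : Kernel Message I) [IsMarkovKernel p] (m : Message) :
    (postMeanI p m : ℝ) = postMean p m := rfl

lemma measurable_postMeanI (p : Kernel Message I) [IsMarkovKernel p] :
    Measurable (postMeanI p) :=
  (measurable_postMean p).subtype_mk

/-- The coercion from `I` to `ℝ` is a measurable embedding, so pulling back recovers the measure on
`I`. -/
lemma map_coe_eq_map_postMean_iff (p : Kernel Message I) [IsMarkovKernel p] (Q : Measure Message) :
    G.map (fun x : I => (x : ℝ)) = Q.map (postMean p) ↔ G = Q.map (postMeanI p) := by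
  have h : Q.map (postMean p) = (Q.map (postMeanI p)).map (fun x : I => (x : ℝ)) :=
    (Measure.map_map measurable_subtype_coe (measurable_postMeanI p)).symm
  rw [h]
  refine ⟨fun h => ?_, fun h => by rw [← h]⟩
  have h' := congrArg (Measure.comap (fun x : I => (x : ℝ))) h
  rwa [unitInterval.measurableEmbedding_coe.comap_map,
    unitInterval.measurableEmbedding_coe.comap_map] at h'

/-- Turns the support condition on beliefs into certainty after the message `{ω}`. -/
lemma eq_dirac_of_support_subset {μ : Measure I} [IsProbabilityMeasure μ] {ω : I}
    (h : ∀ t, t ≠ ω → t ∉ μ.support) : μ = Measure.dirac ω := by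
  have hsub : μ.support ⊆ {ω} := fun t ht => by_contra fun hne => h t hne ht
  have hae : ∀ᵐ t ∂μ, t ∈ ({ω} : Set I) := Filter.mem_of_superset Measure.support_mem_ae hsub
  have h1 : μ.restrict {ω} = μ := Measure.restrict_eq_self_of_ae_mem hae
  have h2 : μ {ω} = 1 := by
    rw [← Measure.restrict_apply_univ, h1, measure_univ]
  rw [← h1, Measure.restrict_singleton, h2, one_smul]

section

variable {κ : Kernel I Message} {τ : Kernel Message (Fin n)} {p : Kernel Message I}
  [IsMarkovKernel p]

lemma IsEquilibrium.payoff_le [IsMarkovKernel τ] (h : E.IsEquilibrium κ τ p) (m : Message) :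
    E.payoff τ m ≤ E.v (E.level (postMeanI p m)) := by
  have hsum : ∑ i, (τ m).real {i} = 1 := by
    rw [sum_measureReal_singleton]; simp
  calc E.payoff τ m ≤ ∑ i, (τ m).real {i} * E.v (E.level (postMeanI p m)) := by
        refine Finset.sum_le_sum fun i _ => ?_
        rcases eq_or_ne (τ m {i}) 0 with h0 | h0
        · simp [measureReal_def, h0]
        · refine mul_le_mul_of_nonneg_left (E.v_strictMono.monotone ?_) measureReal_nonneg
          exact E.le_level_of_mem_A (h.receiver_optimal m i (pos_iff_ne_zero.mpr h0))
    _ = E.v (E.level (postMeanI p m)) := by rw [← Finset.sum_mul, hsum, one_mul]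

/-- Away from the cutoffs a single action is optimal. At a cutoff Receiver may answer `{ω}` with a
lower action; these finitely many states are negligible. -/
lemma IsEquilibrium.payoff_singleton [IsMarkovKernel τ] (h : E.IsEquilibrium κ τ p) {ω : I}
    (hω : ∀ k, (ω : ℝ) ≠ E.γ k) : E.payoff τ {ω} = E.v (E.level ω) := by
  have hp : p {ω} = Measure.dirac ω := eq_dirac_of_support_subset fun t ht =>
    h.belief_support t {ω} (by simpa using ht)
  have hmean : postMean p {ω} = ω := by rw [postMean, hp, integral_dirac]
  have hsum : ∑ i, (τ {ω}).real {i} = 1 := by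
    rw [sum_measureReal_singleton]; simp
  calc E.payoff τ {ω} = ∑ i, (τ {ω}).real {i} * E.v (E.level ω) := by
        refine Finset.sum_congr rfl fun i _ => ?_
        rcases eq_or_ne (τ {ω} {i}) 0 with h0 | h0
        · simp [measureReal_def, h0]
        · have hA := h.receiver_optimal {ω} i (pos_iff_ne_zero.mpr h0)
          rw [hmean] at hA
          congr 2
          refine le_antisymm (E.le_level_of_mem_A hA) (not_lt.mp fun hlt => ?_)
          have h1 : (i.succ : Fin (n + 1)) ≤ (E.level ω).castSucc := by
            rw [Fin.le_def]; exact hlt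
          have h2 := (E.γ_mono h1).trans (E.γ_level_le ω)
          exact hω _ (le_antisymm hA.2 h2)
    _ = E.v (E.level ω) := by rw [← Finset.sum_mul, hsum, one_mul]

variable [IsMarkovKernel κ]

lemma measurable_payoff (τ : Kernel Message (Fin n)) : Measurable (E.payoff τ) := by
  refine Finset.measurable_sum _ fun i _ => ?_
  exact ((τ.measurable_coe (measurableSet_singleton i)).ennreal_toReal).mul_const _

/-- In an equilibrium that gives Sender the full value of the posterior means, almost every state
obtains at least the action that it would recommend. -/
lemma IsEquilibrium.level_le_ae [IsMarkovKernel τ] (h : E.IsEquilibrium κ τ p)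
    (hR : ∫ m, E.v (E.level (postMeanI p m)) ∂(κ ∘ₘ E.prior)
      = ∫ m, E.payoff τ m ∂(κ ∘ₘ E.prior)) :
    ∀ᵐ z ∂(E.prior ⊗ₘ κ), E.level z.1 ≤ E.level (postMeanI p z.2) := by
  have hlm : Measurable fun m => E.level (postMeanI p m) :=
    E.measurable_level.comp (measurable_postMeanI p)
  have hpay : Integrable (E.payoff τ) (κ ∘ₘ E.prior) := by
    refine integrable_finsetSum _ fun i _ => Integrable.mul_const ?_ _
    exact integrable_of_mem_Icc (a := 0) (b := 1)
      ((τ.measurable_coe (measurableSet_singleton i)).ennreal_toReal) fun m =>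
      ⟨measureReal_nonneg, measureReal_le_one⟩
  -- The payoff is bounded pointwise by the value of the posterior mean and the integrals agree, so
  -- the bound is attained almost everywhere.
  have hae : E.payoff τ =ᵐ[κ ∘ₘ E.prior] fun m => E.v (E.level (postMeanI p m)) :=
    (integral_eq_iff_of_ae_le hpay (E.integrable_v _ hlm) (.of_forall h.payoff_le)).mp hR.symm
  have hae' : ∀ᵐ z ∂(E.prior ⊗ₘ κ), E.payoff τ z.2 = E.v (E.level (postMeanI p z.2)) := by
    rw [← Measure.snd_compProd] at hae
    exact ae_of_ae_map measurable_snd.aemeasurable hae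
  have hcut : ∀ᵐ ω : I ∂E.prior, ∀ k, (ω : ℝ) ≠ E.γ k := by
    rw [ae_all_iff]
    intro k
    by_cases hk : E.γ k ∈ I
    · have h0 : E.prior ({⟨E.γ k, hk⟩} : Set I) = 0 := measure_singleton _
      filter_upwards [compl_mem_ae_iff.mpr h0] with ω hω hω'
      exact hω (Subtype.ext hω')
    · exact .of_forall fun ω hω => hk (hω ▸ ω.2)
  have hopt : ∀ᵐ z ∂(E.prior ⊗ₘ κ), E.v (E.level z.1) ≤ E.payoff τ z.2 := by
    refine Measure.ae_compProd_of_ae_ae (measurableSet_le ?_ ?_) ?_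
    · exact (measurable_of_countable E.v).comp (E.measurable_level.comp measurable_fst)
    · exact (measurable_payoff τ).comp measurable_snd
    · filter_upwards [hcut] with ω hω
      filter_upwards [h.sender_optimal ω] with m hm
      exact (h.payoff_singleton hω) ▸ hm {ω} (by simp)
  filter_upwards [hae', hopt] with z h1 h2
  exact E.v_strictMono.le_iff_le.mp (h2.trans h1.le)

/-- The states pooled to posterior means that recommend less than `a_i` lie below `γ_i`. -/
lemma IsEquilibrium.le_γ (h : E.IsEquilibrium κ τ p)
    (hG : G = (κ ∘ₘ E.prior).map (postMeanI p))
    (hlev : ∀ᵐ z ∂(E.prior ⊗ₘ κ), E.level z.1 ≤ E.level (postMeanI p z.2))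
    {D : Set I} (hD : MeasurableSet D) {i : Fin n} (hDi : ∀ x ∈ D, E.level x < i)
    {x y : I} (hxy : x < y) (hmass : E.prior (Icc x y) = G D)
    (hmean : ∫ ω in Icc x y, (ω : ℝ) ∂E.prior = ∫ x in D, (x : ℝ) ∂G) :
    y ≤ E.γ i.castSucc := by
  have hX := measurable_postMeanI p
  set J := E.prior ⊗ₘ κ
  set A : Set (I × Message) := {z | postMeanI p z.2 ∈ D}
  have hA : MeasurableSet A := (hX.comp measurable_snd) hD
  -- `μ` is the law of the state on the event that the posterior mean falls in `D`. The prior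
  -- dominates it, and Bayes' rule makes its first moment that of `G` on `D`.
  set μ : Measure I := (J.restrict A).map Prod.fst with hμ
  have hle : μ ≤ E.prior := by
    calc μ ≤ J.map Prod.fst := Measure.map_mono Measure.restrict_le_self measurable_fst
      _ = E.prior := Measure.fst_compProd _ _
  have hGD : μ univ = G D := by
    rw [hμ, Measure.map_apply measurable_fst .univ, preimage_univ, Measure.restrict_apply_univ,
      hG, Measure.map_apply hX hD, ← Measure.snd_compProd, Measure.snd_apply (hX hD)]
    rfl
  refine E.le_of_le_prior hle hxy ?_ ?_ ?_
  · rw [measureReal_def, hGD, ← hmass, measureReal_def]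
  · rw [hmean]
    have hswap : J = ((κ ∘ₘ E.prior) ⊗ₘ p).map Prod.swap := by
      rw [← h.bayes, Measure.map_map measurable_swap measurable_swap, Prod.swap_swap_eq,
        Measure.map_id]
    calc ∫ t : I, (t : ℝ) ∂μ = ∫ z in A, (z.1 : ℝ) ∂J :=
          integral_map measurable_fst.aemeasurable
            measurable_subtype_coe.aestronglyMeasurable
      _ = ∫ z in (postMeanI p ⁻¹' D) ×ˢ univ, (z.2 : ℝ) ∂((κ ∘ₘ E.prior) ⊗ₘ p) := by
          rw [hswap, setIntegral_map hA (by fun_prop) measurable_swap.aemeasurable]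
          congr 2
          ext z; simp [A]
      _ = ∫ m in postMeanI p ⁻¹' D, (postMeanI p m : ℝ) ∂(κ ∘ₘ E.prior) := by
          rw [Measure.setIntegral_compProd (hX hD) .univ]
          · simp [coe_postMeanI, postMean]
          · exact (integrable_of_mem_Icc (a := 0) (b := 1) (by fun_prop) fun z => z.2.2).integrableOn
      _ = ∫ x in D, (x : ℝ) ∂G := by
          rw [hG, setIntegral_map hD (by fun_prop) hX.aemeasurable]
  · have hm : MeasurableSet {t : I | E.γ i.castSucc < t} :=
      measurableSet_lt measurable_const measurable_subtype_coe
    rw [hμ, Measure.map_apply measurable_fst hm, Measure.restrict_apply (measurable_fst hm)]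
    refine measure_mono_null (fun z hz => ?_) hlev
    intro hz'
    exact (E.le_level_iff.mpr (le_of_lt hz.1)).not_gt (lt_of_le_of_lt hz' (hDi _ hz.2))

end

/-- It suffices to place almost every state above `γ_i` in the closed set of the `B j` with `i ≤ j`.
For revealed states this is immediate. In an interval the equilibrium may split states differently
from `B`, and only the comparison of masses and means in `IsEquilibrium.le_γ` is available. -/
lemma IsCanonicalRep.isIncentiveCompatible (htop : ∀ i : Fin n, E.γ i.castSucc < 1)
    (hB : E.IsCanonicalRep G B) [IsProbabilityMeasure G]
    (hout : E.IsEquilibriumOutcome G (E.designPayoff G)) : E.IsIncentiveCompatible B := by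
  obtain ⟨κ, τ, p, h, hG, hR⟩ := hout
  have := h.markov_κ
  have := h.markov_τ
  have := h.markov_p
  have hX := measurable_postMeanI p
  rw [map_coe_eq_map_postMean_iff] at hG
  have hlev := h.level_le_ae (by
    rw [← hR, designPayoff_eq, hG, integral_map hX.aemeasurable]
    exact ((measurable_of_countable E.v).comp E.measurable_level).aestronglyMeasurable)
  obtain ⟨S, hS, hdet, hnest⟩ := hB
  intro i
  have hU : IsClosed (⋃ j, ⋃ _ : i ≤ j, B j) :=
    isClosed_iUnion_of_finite fun j => isClosed_iUnion_of_finite fun _ => hdet.closed j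
  have hint : ∀ q ∈ S, ∀ ω ∈ Ioo q.1 q.2, E.γ i.castSucc < ω → ω ∈ ⋃ j, ⋃ _ : i ≤ j, B j := by
    intro q hq ω hω hγ
    have hsig : (∃ z ∈ signals G q, i ≤ E.level z) := by
      -- If all means of the interval recommended less than `i`, then `le_γ` applied to the whole
      -- interval would place it below `γ_i`.
      by_contra! hlow
      have := h.le_γ hG hlev (hS.finite_signals hq).measurableSet hlow (hS.lt q hq)
        (hS.measure_signals hq).symm (hS.setIntegral_signals hq).symm
      exact (hγ.trans_le ((Subtype.coe_le_coe.mpr hω.2.le).trans this)).false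
    simp only [mem_iUnion, exists_prop]
    rcases hS.signals_eq hq with ⟨z, hz⟩ | ⟨zL, zH, hlt, hz⟩
    · rw [hz] at hsig
      obtain ⟨_, rfl, hi⟩ := hsig
      exact ⟨_, hi, hdet.pooling q hq _ hz _ (E.recommends_iff.mpr rfl) (Ioo_subset_Icc_self hω)⟩
    · obtain ⟨CL, CH, hC, ⟨x, y, hax, hxy, hyb, hCL, hCH⟩, hLB, hHB⟩ :=
        hnest q hq zL zH hlt hz _ _ (E.recommends_iff.mpr rfl) (E.recommends_iff.mpr rfl)
      have hiH : i ≤ E.level zH := by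
        rw [hz] at hsig
        obtain ⟨z, rfl | rfl, hi⟩ := hsig
        · exact hi.trans (E.level_mono hlt.le)
        · exact hi
      by_cases hiL : i ≤ E.level zL
      · have : ω ∈ CL ∪ CH := hC.union ▸ Ioo_subset_Icc_self hω
        rcases this with hω' | hω'
        · exact ⟨_, hiL, hLB hω'⟩
        · exact ⟨_, hiH, hHB hω'⟩
      · refine ⟨_, hiH, hHB ?_⟩
        have hcell := hS.isCellFamily_biPooling hq hlt hz hC
        have hzL : zL ∈ signals G q := by simp [hz]
        have hm := hcell.mass zL hzL
        have hi := hcell.mean zL hzL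
        rw [if_pos rfl, hCL] at hm hi
        -- A degenerate `CL` would be null, while `zL` is an atom of `G`.
        have hxy' : x < y := by
          refine lt_of_le_of_ne hxy fun hxy => hS.measure_singleton_ne_zero hq hzL ?_
          rw [← hm, hxy, Icc_self, measure_singleton]
        have := h.le_γ hG hlev (measurableSet_singleton zL) (i := i)
          (by rintro _ rfl; exact not_le.mp hiL) hxy' hm (by rw [hi, setIntegral_singleton_coe])
        rw [hCH]
        exact .inr ⟨Subtype.coe_le_coe.mp (this.trans hγ.le), hω.2.le⟩
  have hae : ∀ᵐ ω : I ∂E.prior, E.γ i.castSucc < ω → ω ∈ ⋃ j, ⋃ _ : i ≤ j, B j := by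
    filter_upwards [hdet.revealed] with ω hω hγ
    by_cases hout : ∀ q ∈ S, ω ∉ Ioo q.1 q.2
    · simp only [mem_iUnion, exists_prop]
      exact ⟨_, E.le_level_iff.mpr hγ.le, hω hout _ (E.recommends_iff.mpr rfl)⟩
    · push Not at hout
      obtain ⟨q, hq, hωq⟩ := hout
      exact hint q hq ω hωq hγ
  intro x hx
  have hxI : x ∈ I := by
    refine ⟨?_, ?_⟩
    · exact E.γ_zero.symm.le.trans ((E.γ_mono (Fin.zero_le _)).trans hx.1)
    · exact hx.2.trans ((E.γ_mono (Fin.le_last _)).trans E.γ_last.le)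
  have := E.Ici_subset_of_ae (htop i) hU hae (ω := ⟨x, hxI⟩) hx.1
  simp only [mem_iUnion, exists_prop] at this ⊢
  obtain ⟨j, hj, hmem⟩ := this
  exact ⟨j, hj, ⟨x, hxI⟩, hmem, rfl⟩

end Environment

/-! ### Pooling systems: countably many cells and the revealed states. -/

namespace Environment

variable {n : ℕ} {E : Environment n} {G : Measure I} {S : Set (I × I)}

/-- Prior and signal distribution agree on the closed set `N`; the remaining states are divided
into countably many closed cells `T z`, the cell `T z` being pooled to the posterior mean `z`. -/
structure IsPoolingSystem (E : Environment n) (G : Measure I) (N Z : Set I) (T : I → Set I) :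
    Prop where
  countable : Z.Countable
  isClosed_revealed : IsClosed N
  closed : ∀ z ∈ Z, IsClosed (T z)
  ne_zero : ∀ z ∈ Z, G {z} ≠ 0
  mass : ∀ z ∈ Z, E.prior (T z) = G {z}
  mean : ∀ z ∈ Z, ∫ ω in T z, (ω : ℝ) ∂E.prior = z * G.real {z}
  null_inter : ∀ z ∈ Z, ∀ z' ∈ Z, z ≠ z' → E.prior (T z ∩ T z') = 0
  null_inter_revealed : ∀ z ∈ Z, E.prior (N ∩ T z) = 0
  cover : N ∪ ⋃ z ∈ Z, T z = univ
  reveal : G.restrict N = E.prior.restrict N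
  concentrated : G (N ∪ Z)ᶜ = 0
  disjoint : Disjoint N Z
  finite_crossing : ∀ c : ℝ, {z ∈ Z | c ≤ z ∧ ¬ T z ⊆ {ω : I | c ≤ ω}}.Finite
  isClosed_union : ∀ K ⊆ Z, IsClosed (N ∪ ⋃ z ∈ K, T z)

/-- The states outside the interiors of the intervals of a family. -/
def revealedStates (S : Set (I × I)) : Set I := (⋃ q ∈ S, Ioo q.1 q.2)ᶜ

/-- The posterior means that `G` induces within the intervals of a family. -/
def pooledMeans (G : Measure I) (S : Set (I × I)) : Set I := ⋃ q ∈ S, signals G q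

/-- The cell of a posterior mean, from cells for every interval. -/
def cell (S : Set (I × I)) (T : I × I → I → Set I) (z : I) : Set I :=
  ⋃ q ∈ S, ⋃ _ : z ∈ Ioo q.1 q.2, T q z

namespace IsBiPoolingFamily

lemma cell_eq (hS : E.IsBiPoolingFamily G S) (T : I × I → I → Set I) {q : I × I} (hq : q ∈ S)
    {z : I} (hz : z ∈ signals G q) : cell S T z = T q z := by
  have hz' := hS.signals_subset hq hz
  ext ω
  simp only [cell, mem_iUnion, exists_prop]
  refine ⟨?_, fun h => ⟨q, hq, hz', h⟩⟩
  rintro ⟨q', hq', hzq', h⟩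
  rwa [hS.eq_of_mem hq hq' hz' hzq']

lemma eq_of_mem_Icc (hS : E.IsBiPoolingFamily G S) {q q' : I × I} (hq : q ∈ S) (hq' : q' ∈ S)
    {ω : I} (hω : ω ∈ Ioo q.1 q.2) (hω' : ω ∈ Icc q'.1 q'.2) : q = q' := by
  rw [← closure_Ioo (hS.lt q' hq').ne] at hω'
  obtain ⟨t, ht, ht'⟩ := mem_closure_iff.mp hω' _ isOpen_Ioo hω
  exact hS.eq_of_mem hq hq' ht ht'

lemma Icc_inter_subset (hS : E.IsBiPoolingFamily G S) {q q' : I × I} (hq : q ∈ S) (hq' : q' ∈ S)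
    (hne : q ≠ q') : Icc q.1 q.2 ∩ Icc q'.1 q'.2 ⊆ {q.1, q.2} := by
  intro ω hω
  rw [← Icc_sdiff_Ioo_same (hS.lt q hq).le]
  exact ⟨hω.1, fun h => hne (hS.eq_of_mem_Icc hq hq' h hω.2)⟩

lemma revealedStates_inter_Icc_subset (hS : E.IsBiPoolingFamily G S) {q : I × I} (hq : q ∈ S) :
    revealedStates S ∩ Icc q.1 q.2 ⊆ {q.1, q.2} := by
  intro ω hω
  rw [← Icc_sdiff_Ioo_same (hS.lt q hq).le]
  exact ⟨hω.2, fun h => hω.1 (mem_biUnion hq h)⟩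

/-- Distinct intervals meet only in endpoints, which are null. For `finite_crossing`, a cell with
mean at least `c` that reaches below `c` belongs to the unique interval with `c` in its interior.
For `isClosed_union`, the complement is a union over the intervals of open sets, each removing from
the interior only the finitely many closed cells of that interval. -/
lemma isPoolingSystem (hS : E.IsBiPoolingFamily G S) {T : I × I → I → Set I}
    (hT : ∀ q ∈ S, E.IsCellFamily G q (T q)) :
    E.IsPoolingSystem G (revealedStates S) (pooledMeans G S) (cell S T) := by
  have hsub : ∀ q ∈ S, ∀ z ∈ signals G q, T q z ⊆ Icc q.1 q.2 := fun q hq z hz =>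
    (hT q hq).union ▸ subset_biUnion_of_mem (u := T q) hz
  have hnull : ∀ q : I × I, E.prior {q.1, q.2} = 0 := fun q =>
    (Set.toFinite {q.1, q.2}).countable.measure_zero _
  have hZ : ∀ z ∈ pooledMeans G S, ∃ q ∈ S, z ∈ signals G q ∧ cell S T z = T q z := by
    intro z hz
    simp only [pooledMeans, mem_iUnion, exists_prop] at hz
    obtain ⟨q, hq, hz⟩ := hz
    exact ⟨q, hq, hz, hS.cell_eq T hq hz⟩
  have hmem : ∀ q ∈ S, ∀ z ∈ signals G q, z ∈ pooledMeans G S := fun q hq z hz =>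
    mem_biUnion hq hz
  have hN : IsClosed (revealedStates S) :=
    (isOpen_biUnion fun _ _ => isOpen_Ioo).isClosed_compl
  refine ⟨?_, hN, ?_, ?_, ?_, ?_, ?_, ?_, ?_, hS.reveal, ?_, ?_, ?_, ?_⟩
  · exact hS.countable.biUnion fun q hq => (hS.finite_signals hq).countable
  · intro z hz
    obtain ⟨q, hq, hzq, h⟩ := hZ z hz
    exact h ▸ (hT q hq).closed z hzq
  · intro z hz
    obtain ⟨q, hq, hzq, -⟩ := hZ z hz
    exact hS.measure_singleton_ne_zero hq hzq
  · intro z hz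
    obtain ⟨q, hq, hzq, h⟩ := hZ z hz
    exact h ▸ (hT q hq).mass z hzq
  · intro z hz
    obtain ⟨q, hq, hzq, h⟩ := hZ z hz
    exact h ▸ (hT q hq).mean z hzq
  · intro z hz z' hz' hne
    obtain ⟨q, hq, hzq, h⟩ := hZ z hz
    obtain ⟨q', hq', hzq', h'⟩ := hZ z' hz'
    rw [h, h']
    by_cases hqq : q = q'
    · subst hqq
      exact (hT q hq).null_inter z hzq z' hzq' hne
    · exact measure_mono_null ((inter_subset_inter (hsub q hq z hzq) (hsub q' hq' z' hzq')).trans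
        (hS.Icc_inter_subset hq hq' hqq)) (hnull q)
  · intro z hz
    obtain ⟨q, hq, hzq, h⟩ := hZ z hz
    rw [h]
    exact measure_mono_null ((inter_subset_inter_right _ (hsub q hq z hzq)).trans
      (hS.revealedStates_inter_Icc_subset hq)) (hnull q)
  · refine eq_univ_of_forall fun ω => ?_
    by_cases hω : ω ∈ revealedStates S
    · exact .inl hω
    · simp only [revealedStates, mem_compl_iff, not_not, mem_iUnion, exists_prop] at hω
      obtain ⟨q, hq, hω⟩ := hω
      have := (hT q hq).union.symm ▸ Ioo_subset_Icc_self hω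
      simp only [mem_iUnion, exists_prop] at this
      obtain ⟨z, hz, hωz⟩ := this
      exact .inr (mem_biUnion (hmem q hq z hz) (hS.cell_eq T hq hz ▸ hωz))
  · refine measure_mono_null (t := ⋃ q ∈ S, Ioo q.1 q.2 \ signals G q) (fun ω hω => ?_) ?_
    · rw [compl_union] at hω
      have h1 := hω.1
      simp only [revealedStates, mem_compl_iff, not_not, mem_iUnion, exists_prop] at h1
      obtain ⟨q, hq, hωq⟩ := h1
      exact mem_biUnion hq ⟨hωq, fun h => hω.2 (hmem q hq ω h)⟩
    · refine (measure_biUnion_null_iff hS.countable).mpr fun q hq => ?_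
      have h : G.restrict (Ioo q.1 q.2) (signals G q)ᶜ = 0 := Measure.measure_compl_support
      rwa [Measure.restrict_apply (hS.finite_signals hq).measurableSet.compl, inter_comm] at h
  · refine disjoint_left.mpr fun z hz hz' => ?_
    obtain ⟨q, hq, hzq, -⟩ := hZ z hz'
    exact hz (mem_biUnion hq (hS.signals_subset hq hzq))
  · intro c
    have hcross : ∀ z ∈ {z ∈ pooledMeans G S | c ≤ z ∧ ¬ cell S T z ⊆ {ω : I | c ≤ ω}},
        ∃ q ∈ S, z ∈ signals G q ∧ (q.1 : ℝ) < c ∧ c < q.2 := by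
      rintro z ⟨hz, hcz, hn⟩
      obtain ⟨q, hq, hzq, h⟩ := hZ z hz
      obtain ⟨ω, hω, hωc⟩ := not_subset.mp hn
      refine ⟨q, hq, hzq, ?_, hcz.trans_lt (hS.signals_subset hq hzq).2⟩
      exact lt_of_le_of_lt (hsub q hq z hzq (h ▸ hω)).1 (not_le.mp hωc)
    by_cases hemp : ∃ q ∈ S, (q.1 : ℝ) < c ∧ c < q.2
    · obtain ⟨q, hq, h1, h2⟩ := hemp
      refine (hS.finite_signals hq).subset fun z hz => ?_
      obtain ⟨q', hq', hzq', h1', h2'⟩ := hcross z hz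
      let c' : I := ⟨c, q.1.2.1.trans h1.le, h2.le.trans q.2.2.2⟩
      rwa [hS.eq_of_mem hq hq' (z := c') ⟨h1, h2⟩ ⟨h1', h2'⟩]
    · convert! Set.finite_empty
      refine eq_empty_of_forall_notMem fun z hz => ?_
      obtain ⟨q, hq, -, h⟩ := hcross z hz
      exact hemp ⟨q, hq, h⟩
  · intro K hK
    have : (revealedStates S ∪ ⋃ z ∈ K, cell S T z)ᶜ
        = ⋃ q ∈ S, Ioo q.1 q.2 ∩ (⋃ z ∈ K ∩ signals G q, T q z)ᶜ := by
      ext ω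
      simp only [compl_union, revealedStates, compl_compl, mem_inter_iff, mem_compl_iff,
        mem_iUnion, exists_prop, not_exists, not_and, and_imp]
      constructor
      · rintro ⟨⟨q, hq, hω⟩, h⟩
        exact ⟨q, hq, hω, fun z hzK hz hωz => h z hzK (hS.cell_eq T hq hz ▸ hωz)⟩
      · rintro ⟨q, hq, hω, h⟩
        refine ⟨⟨q, hq, hω⟩, fun z hzK hωz => ?_⟩
        obtain ⟨q', hq', hzq', h'⟩ := hZ z (hK hzK)
        rw [h'] at hωz
        have hqq := hS.eq_of_mem_Icc hq hq' hω (hsub q' hq' z hzq' hωz)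
        subst hqq
        exact h z hzK hzq' hωz
    rw [← isOpen_compl_iff, this]
    refine isOpen_biUnion fun q hq => isOpen_Ioo.inter (isOpen_compl_iff.mpr ?_)
    exact ((hS.finite_signals hq).subset inter_subset_right).isClosed_biUnion fun z hz =>
      (hT q hq).closed z hz.2

end IsBiPoolingFamily

end Environment

/-! ### Measurable selection from messages. -/

lemma isClosed_inter_nonempty {K : Set I} (hK : IsClosed K) :
    IsClosed {m : Message | ((m : Set I) ∩ K).Nonempty} :=
  letI : TopologicalSpace (Set I) := TopologicalSpace.vietoris I
  (vietoris.isClosed_inter_nonempty_of_isClosed hK).preimage NonemptyCompacts.continuous_coe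

lemma isClosed_setOf_subset {K : Set I} (hK : IsClosed K) :
    IsClosed {m : Message | (m : Set I) ⊆ K} :=
  letI : TopologicalSpace (Set I) := TopologicalSpace.vietoris I
  hK.powerset_vietoris.preimage NonemptyCompacts.continuous_coe

/-- The least element of the intersection with a closed set depends measurably on the message. -/
lemma measurable_sInf_inter {K : Set I} (hK : IsClosed K) :
    Measurable fun m : Message => sInf ((m : Set I) ∩ K) := by
  refine measurable_of_Iic fun t => ?_
  -- In `I` the infimum of the empty set is `⊤`, so messages that miss `K` count only for `t = ⊤`.
  rcases eq_or_ne t ⊤ with rfl | ht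
  · simp
  · convert! (isClosed_inter_nonempty (hK.inter (isClosed_Iic (a := t)))).measurableSet using 1
    ext m
    simp only [mem_preimage, mem_Iic, mem_ofPred_eq]
    have hc : IsCompact ((m : Set I) ∩ K) := m.isCompact.inter_right hK
    constructor
    · intro h
      have hne : ((m : Set I) ∩ K).Nonempty := by
        by_contra hemp
        rw [not_nonempty_iff_eq_empty.mp hemp, sInf_empty, top_le_iff] at h
        exact ht h
      have := hc.sInf_mem hne
      exact ⟨_, this.1, this.2, h⟩
    · rintro ⟨x, hx, hxK, hxt⟩
      exact (sInf_le (mem_inter hx hxK)).trans hxt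

/-- An upper semicontinuous integer-valued function has a measurable selection of minimizers over
the messages. -/
lemma exists_measurable_argmin {w : I → ℕ} (hw : ∀ i, IsClosed {ω | i ≤ w ω}) :
    ∃ sel : Message → I, Measurable sel ∧ ∀ m, sel m ∈ m ∧ ∀ ω ∈ m, w (sel m) ≤ w ω := by
  classical
  have hopen : ∀ i, IsOpen {ω | w ω ≤ i} := fun i => by
    have : {ω | w ω ≤ i} = {ω | i + 1 ≤ w ω}ᶜ := by ext ω; simp
    rw [this]; exact (hw _).isOpen_compl
  -- Hitting an open set is not a closed condition on messages, so the open sublevel sets are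
  -- exhausted by closed sets, from which a least point can be chosen measurably.
  choose K hKc hKsub hKU hKm using fun i => (hopen i).exists_iUnion_isClosed
  -- The code `k` stands for a pair `(i, l)`: `i` bounds `w` from below on `m`, and `m` meets a
  -- closed piece of `{w ≤ i}`. Together these make `i` the minimum of `w` on `m`.
  let P : ℕ → Message → Prop := fun k m =>
    (m : Set I) ⊆ {ω | k.unpair.1 ≤ w ω} ∧ ((m : Set I) ∩ K k.unpair.1 k.unpair.2).Nonempty
  have hex : ∀ m : Message, ∃ k, P k m := by
    intro m
    obtain ⟨ω, hωm, hω⟩ : ∃ ω ∈ m, ∀ t ∈ m, w ω ≤ w t := by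
      obtain ⟨t, ht⟩ := m.nonempty
      have hs : (w '' (m : Set I)).Nonempty := ⟨_, t, ht, rfl⟩
      obtain ⟨ω, hω, h⟩ := Nat.sInf_mem hs
      exact ⟨ω, hω, fun t ht => h ▸ Nat.sInf_le ⟨t, ht, rfl⟩⟩
    have hU : ω ∈ ⋃ l, K (w ω) l := by rw [hKU]; simp
    obtain ⟨l, hl⟩ := mem_iUnion.mp hU
    refine ⟨Nat.pair (w ω) l, ?_⟩
    simp only [P, Nat.unpair_pair]
    exact ⟨hω, ω, hωm, hl⟩
  refine ⟨fun m => sInf ((m : Set I) ∩ K (Nat.find (hex m)).unpair.1 (Nat.find (hex m)).unpair.2),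
    ?_, fun m => ?_⟩
  · refine Measurable.find (f := fun k (m : Message) => sInf ((m : Set I) ∩ K k.unpair.1 k.unpair.2))
      (fun k => measurable_sInf_inter (hKc _ _)) (fun k => ?_) hex
    exact ((isClosed_setOf_subset (hw _)).inter (isClosed_inter_nonempty (hKc _ _))).measurableSet
  · obtain ⟨h1, h2⟩ := Nat.find_spec (hex m)
    have hmem := (m.isCompact.inter_right
      (hKc (Nat.find (hex m)).unpair.1 (Nat.find (hex m)).unpair.2)).sInf_mem h2
    refine ⟨hmem.1, fun ω hω => ?_⟩
    have h3 := hKsub _ _ hmem.2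
    exact le_trans h3 (h1 hω)

/-- Finite measures agree if they agree on the points of a countable set and on the measurable sets
disjoint from it. -/
lemma Measure.ext_of_countable {α : Type*} [MeasurableSpace α] [MeasurableSingletonClass α]
    {μ ν : Measure α} {C : Set α} (hC : C.Countable) (h1 : ∀ a ∈ C, μ {a} = ν {a})
    (h2 : ∀ D, MeasurableSet D → Disjoint D C → μ D = ν D) : μ = ν := by
  ext D hD
  have hsingle : ∀ ξ : Measure α, ξ (D ∩ C) = ∑' a : ↑(D ∩ C), ξ {(a : α)} := by
    intro ξ
    conv_lhs => rw [← biUnion_of_singleton (D ∩ C)]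
    exact measure_biUnion (hC.mono inter_subset_right)
      (fun a _ b _ hab => by simpa using hab) fun a _ => measurableSet_singleton a
  rw [← measure_inter_add_sdiff (μ := μ) D hC.measurableSet,
    ← measure_inter_add_sdiff (μ := ν) D hC.measurableSet,
    h2 _ (hD.diff hC.measurableSet) disjoint_sdiff_left, hsingle, hsingle]
  congr 1
  exact tsum_congr fun a => h1 _ a.2.2

/-! ### Sufficiency: an equilibrium from a pooling system. -/

namespace Environment

variable {n : ℕ} {E : Environment n} {G : Measure I} {N Z : Set I} {T : I → Set I}

namespace IsPoolingSystem

lemma prior_ne_zero (hP : E.IsPoolingSystem G N Z T) {z : I} (hz : z ∈ Z) : E.prior (T z) ≠ 0 :=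
  hP.mass z hz ▸ hP.ne_zero z hz

lemma measurableSet_cell (hP : E.IsPoolingSystem G N Z T) {z : I} (hz : z ∈ Z) :
    MeasurableSet (T z) := (hP.closed z hz).measurableSet

lemma ae_disjoint (hP : E.IsPoolingSystem G N Z T) :
    ∀ᵐ ω ∂E.prior, ∀ z ∈ Z, ∀ z' ∈ Z, z ≠ z' → ω ∈ T z → ω ∉ T z' := by
  refine (ae_ball_iff hP.countable).mpr fun z hz => (ae_ball_iff hP.countable).mpr fun z' hz' => ?_
  by_cases hne : z = z'
  · exact .of_forall fun ω h => absurd hne h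
  · filter_upwards [compl_mem_ae_iff.mpr (hP.null_inter z hz z' hz' hne)] with ω hω _ h1 h2
    exact hω ⟨h1, h2⟩

lemma ae_disjoint_revealed (hP : E.IsPoolingSystem G N Z T) :
    ∀ᵐ ω ∂E.prior, ∀ z ∈ Z, ω ∈ N → ω ∉ T z := by
  refine (ae_ball_iff hP.countable).mpr fun z hz => ?_
  filter_upwards [compl_mem_ae_iff.mpr (hP.null_inter_revealed z hz)] with ω hω h1 h2
  exact hω ⟨h1, h2⟩

/-- The messages that reveal the cells of a pooling system. -/
lemma exists_messages (hP : E.IsPoolingSystem G N Z T) :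
    ∃ M : I → Message, ∀ z ∈ Z, (M z : Set I) = T z := by
  classical
  have hne : ∀ z ∈ Z, (T z).Nonempty := fun z hz => nonempty_of_measure_ne_zero (hP.prior_ne_zero hz)
  refine ⟨fun z => if h : z ∈ Z then ⟨⟨T z, (hP.closed z h).isCompact⟩, hne z h⟩ else ⊤,
    fun z hz => ?_⟩
  simp only [hz, dif_pos]
  rfl

/-- Conditioning the prior on the cells changes the measurable map `dirac ∘ sel` at countably many
messages only, so the result is still a kernel. -/
lemma exists_belief (hP : E.IsPoolingSystem G N Z T) {M : I → Message}
    (hM : ∀ z ∈ Z, (M z : Set I) = T z) {sel : Message → I} (hsel : Measurable sel) :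
    ∃ p : Kernel Message I, IsMarkovKernel p ∧ (∀ z ∈ Z, p (M z) = E.prior[|T z]) ∧
      ∀ m ∉ M '' Z, p m = Measure.dirac (sel m) := by
  classical
  have hcount : (M '' Z).Countable := hP.countable.image M
  let g : Message → Measure I := fun m =>
    if m ∈ M '' Z then E.prior[|(m : Set I)] else Measure.dirac (sel m)
  have hg : Measurable g := by
    refine Measurable.measurable_of_countable_ne (Measure.measurable_dirac.comp hsel)
      (hcount.mono fun m hm => ?_)
    by_contra h
    exact hm (by simp only [g, if_neg h, Function.comp])
  refine ⟨⟨g, hg⟩, ⟨fun m => ?_⟩, fun z hz => ?_, fun m hm => if_neg hm⟩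
  · change IsProbabilityMeasure (g m)
    by_cases h : m ∈ M '' Z
    · obtain ⟨z, hz, rfl⟩ := h
      simp only [g, if_pos (mem_image_of_mem M hz), hM z hz]
      exact cond_isProbabilityMeasure (hP.prior_ne_zero hz)
    · simp only [g, if_neg h]
      infer_instance
  · change g (M z) = _
    simp only [g, if_pos (mem_image_of_mem M hz), hM z hz]

/-- Measurable strategies that send the message of a cell whenever that attains the level `w`, and
reveal the state otherwise. -/
lemma exists_strategy (hP : E.IsPoolingSystem G N Z T) (M : I → Message) {w : I → ℕ}
    (hw : ∀ k, IsClosed {ω | k ≤ w ω}) :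
    ∃ s : I → Message, Measurable s ∧ ∀ ω,
      (∃ z ∈ Z, ω ∈ T z ∧ w ω ≤ E.level z ∧ s ω = M z) ∨
        ((∀ z ∈ Z, ω ∈ T z → ¬ w ω ≤ E.level z) ∧ s ω = {ω}) := by
  classical
  obtain ⟨e, he⟩ := countable_iff_exists_subset_range.mp hP.countable
  let good : ℕ → I → Prop := fun k ω => e k ∈ Z ∧ ω ∈ T (e k) ∧ w ω ≤ E.level (e k)
  have hgood : ∀ k, MeasurableSet {ω | good k ω} := by
    intro k
    by_cases hk : e k ∈ Z
    · have : {ω | good k ω} = T (e k) ∩ {ω | (E.level (e k) : ℕ) + 1 ≤ w ω}ᶜ := by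
        ext ω; simp [good, hk]
      rw [this]
      exact (hP.measurableSet_cell hk).inter (hw _).measurableSet.compl
    · have : {ω | good k ω} = ∅ := by ext ω; simp [good, hk]
      rw [this]; exact .empty
  have hnone : MeasurableSet {ω | ∀ j, ¬ good j ω} := by
    have : {ω | ∀ j, ¬ good j ω} = ⋂ j, {ω | good j ω}ᶜ := by ext ω; simp
    rw [this]; exact .iInter fun j => (hgood j).compl
  -- The second disjunct makes the search succeed, with a dummy index, at states without a good
  -- cell; there `g` reveals the state.
  let P : ℕ → I → Prop := fun k ω => good k ω ∨ ∀ j, ¬ good j ω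
  have hex : ∀ ω, ∃ k, P k ω := fun ω => by
    by_cases h : ∃ k, good k ω
    · exact h.imp fun k hk => .inl hk
    · exact ⟨0, .inr (not_exists.mp h)⟩
  let g : ℕ → I → Message := fun k ω => if ∀ j, ¬ good j ω then {ω} else M (e k)
  refine ⟨fun ω => g (Nat.find (hex ω)) ω, Measurable.find (fun k => ?_) (fun k => ?_) hex,
    fun ω => ?_⟩
  · exact Measurable.ite hnone NonemptyCompacts.continuous_singleton.measurable measurable_const
  · exact (hgood k).union hnone
  · by_cases h : ∀ j, ¬ good j ω
    · refine .inr ⟨fun z hz hω hle => ?_, if_pos h⟩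
      obtain ⟨k, rfl⟩ := he hz
      exact h k ⟨hz, hω, hle⟩
    · have hspec := (Nat.find_spec (hex ω)).resolve_right h
      exact .inl ⟨_, hspec.1, hspec.2.1, hspec.2.2, if_neg h⟩

/-- The states that can obtain the level `k` by revealing themselves or their cell. -/
def attainable (E : Environment n) (Z : Set I) (T : I → Set I) (k : ℕ) : Set I :=
  {ω | k ≤ E.level ω} ∪ ⋃ z ∈ {z ∈ Z | k ≤ E.level z}, T z

/-- This is the upper semicontinuity of the attained level. Cells lying in `{ω | γ_i ≤ ω}` are
absorbed by that closed set, and `finite_crossing` leaves finitely many others. -/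
lemma isClosed_attainable (hP : E.IsPoolingSystem G N Z T) (k : ℕ) :
    IsClosed (attainable E Z T k) := by
  by_cases hk : k < n
  · let i : Fin n := ⟨k, hk⟩
    have hi : ∀ x, k ≤ E.level x ↔ E.γ i.castSucc ≤ x := fun x => E.le_level_iff (k := i)
    have : attainable E Z T k = {ω : I | E.γ i.castSucc ≤ ω} ∪
        ⋃ z ∈ {z ∈ Z | E.γ i.castSucc ≤ z ∧ ¬ T z ⊆ {ω : I | E.γ i.castSucc ≤ ω}}, T z := by
      ext ω
      simp only [attainable, hi, mem_union, mem_ofPred_eq, mem_iUnion, exists_prop]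
      constructor
      · rintro (h | ⟨z, ⟨hz, hle⟩, hω⟩)
        · exact .inl h
        · by_cases hsub : T z ⊆ {ω : I | E.γ i.castSucc ≤ ω}
          · exact .inl (hsub hω)
          · exact .inr ⟨z, ⟨hz, hle, hsub⟩, hω⟩
      · rintro (h | ⟨z, ⟨hz, hle, -⟩, hω⟩)
        · exact .inl h
        · exact .inr ⟨z, ⟨hz, hle⟩, hω⟩
    rw [this]
    exact (isClosed_le continuous_const continuous_subtype_val).union
      ((hP.finite_crossing _).isClosed_biUnion fun z hz => hP.closed z hz.1)
  · have : attainable E Z T k = ∅ := by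
      refine eq_empty_of_forall_notMem fun ω hω => ?_
      have h : ∀ x, ¬ k ≤ E.level x := fun x hx => hk (hx.trans_lt (E.level x).2)
      simp [attainable, h] at hω
    rw [this]; exact isClosed_empty

/-- The sets `attainable E Z T k` decrease in `k`, are everything at `k = 0`, and are empty beyond
`n`, so the largest admissible `k` serves as `w`. -/
lemma exists_attained (E : Environment n) (Z : Set I) (T : I → Set I) :
    ∃ w : I → ℕ, ∀ k ω, k ≤ w ω ↔ ω ∈ attainable E Z T k := by
  classical
  have hanti : ∀ k l ω, k ≤ l → ω ∈ attainable E Z T l → ω ∈ attainable E Z T k := by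
    intro k l ω hkl
    simp only [attainable, mem_union, mem_ofPred_eq, mem_iUnion, exists_prop]
    rintro (h | ⟨z, ⟨hz, hle⟩, hω⟩)
    · exact .inl (hkl.trans h)
    · exact .inr ⟨z, ⟨hz, hkl.trans hle⟩, hω⟩
  have hlt : ∀ k ω, ω ∈ attainable E Z T k → k ≤ n := by
    intro k ω
    simp only [attainable, mem_union, mem_ofPred_eq, mem_iUnion, exists_prop]
    rintro (h | ⟨z, ⟨-, hle⟩, -⟩)
    · exact h.trans (E.level ω).2.le
    · exact hle.trans (E.level z).2.le
  refine ⟨fun ω => Nat.findGreatest (fun k => ω ∈ attainable E Z T k) n, fun k ω => ⟨fun h => ?_,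
    fun h => Nat.le_findGreatest (hlt k ω h) h⟩⟩
  refine hanti _ _ _ h (Nat.findGreatest_spec (m := 0) (P := fun k => ω ∈ attainable E Z T k)
    (Nat.zero_le n) ?_)
  exact .inl (Nat.zero_le _)

/-- A pooling system whose cells recommend at least what their states recommend is the outcome of
an equilibrium in which Sender sends cells or reveals the state. -/
theorem isEquilibriumOutcome (hP : E.IsPoolingSystem G N Z T)
    (hIC : ∀ z ∈ Z, ∀ᵐ ω ∂E.prior, ω ∈ T z → E.level ω ≤ E.level z) :
    E.IsEquilibriumOutcome G (E.designPayoff G) := by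
  obtain ⟨w, hw⟩ := exists_attained E Z T
  have hwc : ∀ k, IsClosed {ω | k ≤ w ω} := fun k => by
    simp only [hw]; exact hP.isClosed_attainable k
  obtain ⟨sel, hselm, hsel⟩ := exists_measurable_argmin hwc
  obtain ⟨M, hM⟩ := hP.exists_messages
  obtain ⟨p, hp, hpM, hpsel⟩ := hP.exists_belief hM hselm
  obtain ⟨s, hsm, hs⟩ := hP.exists_strategy M hwc
  have hX := measurable_postMeanI p
  have hτ : Measurable fun m => E.level (postMeanI p m) := E.measurable_level.comp hX
  have hpay : ∀ m, E.payoff (Kernel.deterministic _ hτ) m = E.v (E.level (postMeanI p m)) := by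
    intro m
    rw [payoff, Finset.sum_eq_single (E.level (postMeanI p m))]
    · simp [Kernel.deterministic_apply, measureReal_def]
    · intro i _ hi
      simp [Kernel.deterministic_apply, measureReal_def, hi.symm]
    · simp
  have hXM : ∀ z ∈ Z, postMeanI p (M z) = z := by
    intro z hz
    apply Subtype.ext
    rw [coe_postMeanI, postMean, hpM z hz, ProbabilityTheory.cond, integral_smul_measure,
      hP.mean z hz, hP.mass z hz, ENNReal.toReal_inv, smul_eq_mul, ← measureReal_def, mul_comm,
      mul_assoc, mul_inv_cancel₀, mul_one]
    rw [measureReal_def, ENNReal.toReal_ne_zero]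
    refine ⟨hP.ne_zero z hz, ?_⟩
    rw [← hP.mass z hz]; exact measure_ne_top _ _
  have hXsel : ∀ m ∉ M '' Z, postMeanI p m = sel m := by
    intro m hm
    apply Subtype.ext
    rw [coe_postMeanI, postMean, hpsel m hm, integral_dirac]
  -- Cells have positive prior probability, singletons none.
  have hsing : ∀ ω : I, ({ω} : Message) ∉ M '' Z := by
    rintro ω ⟨z, hz, h⟩
    refine hP.prior_ne_zero hz ?_
    rw [← hM z hz, h]; exact measure_singleton ω
  have hselsing : ∀ ω : I, sel {ω} = ω := fun ω => by simpa using (hsel {ω}).1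
  have hXsing : ∀ ω : I, postMeanI p {ω} = ω := fun ω => by
    rw [hXsel _ (hsing ω), hselsing]
  have hmem : ∀ ω, ω ∈ s ω := by
    intro ω
    rcases hs ω with ⟨z, hz, hω, -, h⟩ | ⟨-, h⟩
    · rw [h, ← SetLike.mem_coe, hM z hz]; exact hω
    · rw [h]; simp
  have hattain : ∀ ω, w ω ≤ E.level (postMeanI p (s ω)) := by
    intro ω
    rcases hs ω with ⟨z, hz, hω, hle, h⟩ | ⟨hno, h⟩
    · rwa [h, hXM z hz]
    · rw [h, hXsing]
      have := (hw _ ω).mp le_rfl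
      simp only [attainable, mem_union, mem_ofPred_eq, mem_iUnion, exists_prop] at this
      rcases this with h | ⟨z, ⟨hz, hle⟩, hω⟩
      · exact h
      · exact absurd hle (hno z hz hω)
  -- No message yields more than `w ω`: a cell containing `ω` is counted in `attainable`, and any
  -- other message is attributed to `sel m`, whose own level is at most `w (sel m) ≤ w ω`.
  have hbound : ∀ ω (m : Message), ω ∈ m → E.level (postMeanI p m) ≤ w ω := by
    intro ω m hω
    by_cases hm : m ∈ M '' Z
    · obtain ⟨z, hz, rfl⟩ := hm
      rw [hXM z hz, hw]
      rw [← SetLike.mem_coe, hM z hz] at hω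
      exact .inr (mem_biUnion (mem_sep hz le_rfl) hω)
    · rw [hXsel m hm]
      refine le_trans ?_ ((hsel m).2 ω hω)
      rw [hw]; exact .inl (le_refl (E.level (sel m) : ℕ))
  have hdisj := hP.ae_disjoint
  have hdisjN := hP.ae_disjoint_revealed
  -- Here `hIC` enters: almost every state has at most one cell and gains nothing by revealing
  -- itself instead of sending it.
  have hcell : ∀ᵐ ω ∂E.prior, ∀ z ∈ Z, ω ∈ T z → s ω = M z := by
    filter_upwards [hdisj, (ae_ball_iff hP.countable).mpr hIC] with ω h1 h2 z hz hω
    have huniq : ∀ z' ∈ Z, ω ∈ T z' → z' = z := fun z' hz' hω' =>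
      by_contra fun hne => h1 z' hz' z hz hne hω' hω
    have hle : w ω ≤ E.level z := by
      have := (hw _ ω).mp le_rfl
      simp only [attainable, mem_union, mem_ofPred_eq, mem_iUnion, exists_prop] at this
      rcases this with h | ⟨z', ⟨hz', hle⟩, hω'⟩
      · exact h.trans (h2 z hz hω)
      · exact huniq z' hz' hω' ▸ hle
    rcases hs ω with ⟨z', hz', hω', -, h⟩ | ⟨hno, -⟩
    · rw [h, huniq z' hz' hω']
    · exact absurd hle (hno z hz hω)
  have hsN : ∀ᵐ ω ∂E.prior, (ω ∈ N ∧ s ω = {ω}) ∨ (ω ∉ N ∧ ∃ z ∈ Z, ω ∈ T z ∧ s ω = M z) := by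
    filter_upwards [hcell, hdisjN] with ω h1 h2
    by_cases hN : ω ∈ N
    · refine .inl ⟨hN, ?_⟩
      rcases hs ω with ⟨z, hz, hω, -, -⟩ | ⟨-, h⟩
      · exact absurd hω (h2 z hz hN)
      · exact h
    · have := hP.cover.symm ▸ mem_univ ω
      simp only [mem_union, hN, false_or, mem_iUnion, exists_prop] at this
      obtain ⟨z, hz, hω⟩ := this
      exact .inr ⟨hN, z, hz, hω, h1 z hz hω⟩
  have hpre : ∀ z ∈ Z, s ⁻¹' {M z} =ᵐ[E.prior] T z := by
    intro z hz
    filter_upwards [hcell] with ω hω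
    refine propext ⟨fun h => ?_, fun h => hω z hz h⟩
    have h' := hmem ω
    rwa [show s ω = M z from h, ← SetLike.mem_coe, hM z hz] at h'
  have hQ : (Kernel.deterministic s hsm) ∘ₘ E.prior = E.prior.map s :=
    Measure.deterministic_comp_eq_map hsm
  have hGmap : G = (E.prior.map s).map (postMeanI p) := by
    rw [Measure.map_map hX hsm]
    refine Measure.ext_of_countable hP.countable (fun z hz => ?_) fun D hD hDZ => ?_
    · rw [Measure.map_apply (hX.comp hsm) (measurableSet_singleton z), ← hP.mass z hz]
      refine measure_congr ?_
      filter_upwards [hcell, hsN, compl_mem_ae_iff.mpr (measure_singleton (μ := E.prior) z)]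
        with ω h1 h2 h3
      refine propext ⟨fun h => ?_, fun h => ?_⟩
      · change postMeanI p (s ω) = z
        rw [h1 z hz h, hXM z hz]
      · have h : postMeanI p (s ω) = z := h
        rcases h2 with ⟨-, h4⟩ | ⟨-, z', hz', hω, h4⟩
        · rw [h4, hXsing] at h
          exact absurd h h3
        · rw [h4, hXM z' hz'] at h
          exact h ▸ hω
    · have hGD : G D = E.prior (D ∩ N) := by
        have hNm := hP.isClosed_revealed.measurableSet
        rw [← Measure.restrict_apply' hNm, ← hP.reveal, Measure.restrict_apply' hNm,
          ← measure_inter_add_sdiff D hNm]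
        refine (congrArg _ (measure_mono_null (fun ω hω => ?_) hP.concentrated)).trans (add_zero _)
        exact fun h => h.elim hω.2 (disjoint_left.mp hDZ hω.1)
      rw [hGD, Measure.map_apply (hX.comp hsm) hD]
      refine measure_congr ?_
      filter_upwards [hsN] with ω h
      refine propext ?_
      change ω ∈ D ∩ N ↔ postMeanI p (s ω) ∈ D
      rcases h with ⟨hN, h⟩ | ⟨hN, z, hz, hω, h⟩
      · rw [h, hXsing]; simp [hN]
      · rw [h, hXM z hz]
        exact ⟨fun h => absurd h.2 hN, fun h => absurd hz (disjoint_left.mp hDZ h)⟩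
  refine ⟨Kernel.deterministic s hsm, Kernel.deterministic _ hτ, p, ?_, ?_, ?_⟩
  · refine ⟨inferInstance, inferInstance, hp, fun ω => ?_, fun ω => ?_, fun m i hi => ?_,
      fun ω m hω => ?_, ?_⟩
    · rw [Kernel.deterministic_apply, ae_dirac_eq]; exact hmem ω
    · rw [Kernel.deterministic_apply, ae_dirac_eq]
      intro m hm
      rw [hpay, hpay]
      exact E.v_strictMono.monotone (Fin.le_def.mpr ((hbound ω m hm).trans (hattain ω)))
    · have : i = E.level (postMeanI p m) := by
        by_contra h
        rw [Kernel.deterministic_apply, Measure.dirac_apply' _ (measurableSet_singleton i)] at hi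
        simp [Ne.symm h] at hi
      rw [this]
      exact E.mem_A_level (postMeanI p m)
    · refine Measure.notMem_support_iff_exists.mpr
        ⟨(m : Set I)ᶜ, m.isCompact.isClosed.isOpen_compl.mem_nhds hω, ?_⟩
      by_cases hm : m ∈ M '' Z
      · obtain ⟨z, hz, rfl⟩ := hm
        rw [hpM z hz, cond_apply (hP.measurableSet_cell hz), hM z hz, inter_compl_self,
          measure_empty, mul_zero]
      · rw [hpsel m hm, Measure.dirac_apply' _ m.isCompact.isClosed.measurableSet.compl]
        simp [(hsel m).1]
    · rw [hQ, Measure.compProd_deterministic, Measure.map_map measurable_swap (by fun_prop)]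
      -- Bayes' rule on rectangles. On each of the countably many cell messages it is the definition
      -- of conditional probability; every other message sent is a singleton, answered by a point
      -- mass at the state.
      have hpC : ∀ C, MeasurableSet C → (E.prior.restrict C).map s
          = (E.prior.map s).withDensity fun m => p m C := by
        intro C hC
        have hpm : Measurable fun m => p m C := p.measurable_coe hC
        refine Measure.ext_of_countable (hP.countable.image M) ?_ fun D hD hDZ => ?_
        · rintro _ ⟨z, hz, rfl⟩
          rw [withDensity_apply _ (measurableSet_singleton _), lintegral_singleton,
            Measure.map_apply hsm (measurableSet_singleton _),
            Measure.map_apply hsm (measurableSet_singleton _),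
            Measure.restrict_apply (hsm (measurableSet_singleton _)), hpM z hz,
            measure_congr (hpre z hz), cond_mul_eq_inter (hP.measurableSet_cell hz)]
          exact measure_congr ((hpre z hz).inter (ae_eq_refl C))
        · rw [withDensity_apply _ hD, setLIntegral_map hD hpm hsm, Measure.map_apply hsm hD,
            Measure.restrict_apply (hsm hD)]
          have : ∫⁻ ω in s ⁻¹' D, p (s ω) C ∂E.prior = ∫⁻ ω in s ⁻¹' D, C.indicator 1 ω ∂E.prior := by
            refine setLIntegral_congr_fun (hsm hD) fun ω hω => ?_
            have hns : s ω ∉ M '' Z := disjoint_left.mp hDZ hω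
            rcases hs ω with ⟨z, hz, -, -, h⟩ | ⟨-, h⟩
            · exact absurd (h ▸ mem_image_of_mem M hz) hns
            · rw [h, hpsel _ (hsing ω), hselsing, Measure.dirac_apply' _ hC]
          rw [this, lintegral_indicator_one hC, Measure.restrict_apply hC, inter_comm]
      refine Measure.ext_prod fun {D C} hD hC => ?_
      rw [Measure.map_apply (by fun_prop) (hD.prod hC), Measure.compProd_apply_prod hD hC,
        ← withDensity_apply _ hD, ← hpC C hC, Measure.map_apply hsm hD,
        Measure.restrict_apply (hsm hD)]
      rfl
  · rw [hQ]
    exact (map_coe_eq_map_postMean_iff p _).mpr hGmap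
  · rw [hQ, designPayoff_eq]
    simp_rw [hpay]
    conv_lhs => rw [hGmap]
    rw [integral_map hX.aemeasurable]
    exact ((measurable_of_countable E.v).comp E.measurable_level).aestronglyMeasurable

end IsPoolingSystem

end Environment

/-! ### Nested intervals within a bi-pooling interval. -/

lemma continuous_setIntegral_Iic (μ : Measure I) [IsFiniteMeasure μ] [NullSingletonClass μ]
    {g : I → ℝ} (hg : Integrable g μ) : Continuous fun s : I => ∫ t in Iic s, g t ∂μ := by
  simp_rw [← integral_indicator measurableSet_Iic]
  refine continuous_iff_continuousAt.mpr fun s => ?_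
  refine continuousAt_of_dominated (bound := fun t => ‖g t‖)
    (.of_forall fun x => hg.aestronglyMeasurable.indicator measurableSet_Iic)
    (.of_forall fun x => .of_forall fun t => norm_indicator_le_norm_self _ _) hg.norm ?_
  filter_upwards [compl_mem_ae_iff.mpr (measure_singleton (μ := μ) s)] with t ht
  rcases lt_or_gt_of_ne (show t ≠ s from ht) with h | h
  · refine (continuousAt_const (y := g t)).congr ?_
    filter_upwards [isOpen_Ioi.mem_nhds h] with x hx
    exact (indicator_of_mem (mem_Iic.mpr (le_of_lt hx)) _).symm
  · refine (continuousAt_const (y := (0 : ℝ))).congr ?_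
    filter_upwards [isOpen_Iio.mem_nhds h] with x hx
    exact (indicator_of_notMem (by simpa using hx) _).symm

lemma setIntegral_Icc_eq_sub (μ : Measure I) [IsFiniteMeasure μ] [NullSingletonClass μ]
    {g : I → ℝ} (hg : Integrable g μ) {x y : I} (hxy : x ≤ y) :
    ∫ t in Icc x y, g t ∂μ = ∫ t in Iic y, g t ∂μ - ∫ t in Iic x, g t ∂μ := by
  rw [setIntegral_congr_set Ioc_ae_eq_Icc.symm, ← Iic_union_Ioc_eq_Iic hxy,
    setIntegral_union _ measurableSet_Ioc hg.integrableOn hg.integrableOn]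
  · ring
  · exact disjoint_left.mpr fun t ht ht' => ht'.1.not_ge ht

namespace Environment

variable {n : ℕ} {E : Environment n} {G : Measure I} {S : Set (I × I)}

lemma measureReal_Icc_eq_sub (E : Environment n) {x y : I} (hxy : x ≤ y) :
    E.prior.real (Icc x y) = E.prior.real (Iic y) - E.prior.real (Iic x) := by
  simpa using setIntegral_Icc_eq_sub E.prior (integrable_const (1 : ℝ)) hxy

/-- Within an interval of states, a part with given mass and mean can be taken to be a subinterval
if its mean lies between that of the lowest part of the same mass and that of its complement. -/
lemma exists_Icc_mass_mean (E : Environment n) {a b : I} {zL zH pL pH : ℝ}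
    (hL : 0 < pL) (hH : 0 < pH) (hz : zL < zH) (hmass : pL + pH = E.prior.real (Icc a b))
    (hmean : pL * zL + pH * zH = ∫ ω in Icc a b, (ω : ℝ) ∂E.prior)
    (hlow : ∀ y ∈ Icc a b, E.prior.real (Icc a y) = pL →
      ∫ ω in Icc a y, (ω : ℝ) ∂E.prior ≤ pL * zL) :
    ∃ x y : I, a ≤ x ∧ x ≤ y ∧ y ≤ b ∧ E.prior.real (Icc x y) = pL ∧
      ∫ ω in Icc x y, (ω : ℝ) ∂E.prior = pL * zL := by
  have hab : a ≤ b := by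
    by_contra h
    rw [Icc_eq_empty h, measureReal_empty] at hmass
    linarith
  set M : I → ℝ := fun s => E.prior.real (Iic s) with hM
  have hMc : Continuous M := by
    simpa using continuous_setIntegral_Iic E.prior (integrable_const (1 : ℝ))
  have hMsub : ∀ {x y : I}, x ≤ y → E.prior.real (Icc x y) = M y - M x :=
    fun h => E.measureReal_Icc_eq_sub h
  have hM01 : ∀ s, M s ∈ I := fun s => ⟨measureReal_nonneg, measureReal_le_one⟩
  have hMmono : StrictMono M := fun x y hxy => by
    have h1 := hMsub hxy.le
    have h2 : 0 < E.prior.real (Icc x y) := measureReal_def E.prior _ ▸ ENNReal.toReal_pos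
      (E.prior_pos_of_Ioo_subset hxy Ioo_subset_Icc_self).ne' (measure_ne_top _ _)
    linarith
  have hM0 : M 0 = 0 := by
    have : Iic (0 : I) = {0} := Iic_bot
    simp [hM, this, measureReal_def]
  have hM1 : M 1 = 1 := by
    have : Iic (1 : I) = univ := Iic_top
    simp [hM, this]
  let M' : I → I := fun s => ⟨M s, hM01 s⟩
  have hM'mono : StrictMono M' := fun x y hxy => hMmono hxy
  have hM'surj : Function.Surjective M' := fun t =>
    mem_range_of_exists_le_of_exists_ge (hMc.subtype_mk hM01)
      ⟨0, Subtype.coe_le_coe.mp (hM0.le.trans t.2.1)⟩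
      ⟨1, Subtype.coe_le_coe.mp (t.2.2.trans hM1.ge)⟩
  let e : I ≃o I := hM'mono.orderIsoOfSurjective M' hM'surj
  have he : ∀ t, M (e.symm t) = t := fun t => congrArg Subtype.val (e.apply_symm_apply t)
  -- `Y x` is the right end of the window of prior mass `pL` starting at `x`. The projection clips
  -- windows that would run past `1`, which keeps `Y` continuous on all of `I`.
  let Y : I → I := fun x => e.symm (projIcc 0 1 zero_le_one (M x + pL))
  have hYc : Continuous Y := e.symm.continuous.comp
    (continuous_projIcc.comp (hMc.add continuous_const))
  have hMY : ∀ x, M x + pL ≤ 1 → M (Y x) = M x + pL := by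
    intro x hx
    simp only [Y, he]
    rw [projIcc_of_mem zero_le_one ⟨add_nonneg (hM01 x).1 hL.le, hx⟩]
  have hMab : M b - M a = pL + pH := by rw [hmass, hMsub hab]
  -- `x₁` is the last admissible left end: its window is `[x₁, b]`.
  obtain ⟨x₁, hx₁⟩ := hM'surj ⟨M b - pL, by linarith [(hM01 a).1], by linarith [(hM01 b).2]⟩
  have hMx₁ : M x₁ = M b - pL := congrArg Subtype.val hx₁
  have hax₁ : a ≤ x₁ := hMmono.le_iff_le.mp (by linarith)
  have hx₁b : x₁ ≤ b := hMmono.le_iff_le.mp (by linarith)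
  have hYx : ∀ x, x ≤ x₁ → M (Y x) = M x + pL ∧ x ≤ Y x ∧ Y x ≤ b := by
    intro x hx
    have h1 := hMmono.monotone hx
    have h2 := hMY x (by linarith [(hM01 b).2])
    exact ⟨h2, hMmono.le_iff_le.mp (by linarith), hMmono.le_iff_le.mp (by linarith)⟩
  have hid := integrable_coe_unitInterval E.prior
  set C : I → ℝ := fun s => ∫ t in Iic s, (t : ℝ) ∂E.prior with hC
  have hCc : Continuous C := continuous_setIntegral_Iic E.prior hid
  have hCsub : ∀ {x y : I}, x ≤ y → ∫ ω in Icc x y, (ω : ℝ) ∂E.prior = C y - C x :=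
    fun h => setIntegral_Icc_eq_sub E.prior hid h
  have hD : ContinuousOn (fun x => C (Y x) - C x) (Icc a x₁) :=
    ((hCc.comp hYc).sub hCc).continuousOn
  have h1 : C (Y a) - C a ≤ pL * zL := by
    obtain ⟨h2, h3, h4⟩ := hYx a hax₁
    rw [← hCsub h3]
    exact hlow _ ⟨h3, h4⟩ (by rw [hMsub h3, h2]; ring)
  -- If the top window had mean below `zL`, then `x₁ < zL < zH`; the rest `[a, x₁]` would have mean
  -- at most `x₁ < zH`, and the total would fall short of `hmean`.
  have h2 : pL * zL ≤ C (Y x₁) - C x₁ := by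
    have hYb : Y x₁ = b := hMmono.injective (by rw [(hYx x₁ le_rfl).1, hMx₁]; ring)
    rw [hYb]
    by_contra! hlt
    have h3 : pL * x₁ ≤ C b - C x₁ := by
      rw [← hCsub hx₁b]
      calc pL * x₁ = ∫ _ in Icc x₁ b, (x₁ : ℝ) ∂E.prior := by
            simp only [setIntegral_const, smul_eq_mul, hMsub hx₁b, hMx₁]; ring
        _ ≤ ∫ ω in Icc x₁ b, (ω : ℝ) ∂E.prior :=
            setIntegral_mono_on (integrable_const _).integrableOn hid.integrableOn
              measurableSet_Icc fun t ht => ht.1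
    have h4 : C x₁ - C a ≤ pH * x₁ := by
      rw [← hCsub hax₁]
      calc ∫ ω in Icc a x₁, (ω : ℝ) ∂E.prior ≤ ∫ _ in Icc a x₁, (x₁ : ℝ) ∂E.prior :=
            setIntegral_mono_on hid.integrableOn (integrable_const _).integrableOn
              measurableSet_Icc fun t ht => ht.2
        _ = pH * x₁ := by
            simp only [setIntegral_const, smul_eq_mul, hMsub hax₁, hMx₁]
            congr 1; linarith
    have h5 : (x₁ : ℝ) < zL := lt_of_mul_lt_mul_left (h3.trans_lt hlt) hL.le
    have h6 : pH * x₁ < pH * zH := mul_lt_mul_of_pos_left (h5.trans hz) hH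
    rw [hCsub hab] at hmean
    linarith
  obtain ⟨x, hx, hxD⟩ := intermediate_value_Icc hax₁ hD ⟨h1, h2⟩
  obtain ⟨h3, h4, h5⟩ := hYx x hx.2
  refine ⟨x, Y x, hx.1, h4, h5, ?_, ?_⟩
  · rw [hMsub h4, h3]; ring
  · rw [hCsub h4]; exact hxD

namespace IsBiPoolingFamily

variable {q : I × I}

/-- The prior and a bi-pooling distribution give the same integral to functions that are affine on
every interval of the family. -/
lemma integral_eq [IsFiniteMeasure G] (hS : E.IsBiPoolingFamily G S) {φ : I → ℝ}
    (hφ : ∀ μ : Measure I, IsFiniteMeasure μ → Integrable φ μ)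
    (haff : ∀ q ∈ S, ∃ α β : ℝ, ∀ t ∈ Ioo q.1 q.2, φ t = α + β * t) :
    ∫ t, φ t ∂G = ∫ t, φ t ∂E.prior := by
  have hUm : MeasurableSet (⋃ q ∈ S, Ioo q.1 q.2) :=
    (isOpen_biUnion fun _ _ => isOpen_Ioo).measurableSet
  rw [← integral_add_compl hUm (hφ G inferInstance),
    ← integral_add_compl hUm (hφ E.prior inferInstance), hS.reveal]
  congr 1
  have := hS.countable.to_subtype
  rw [biUnion_eq_iUnion]
  have hd : Pairwise (Function.onFun Disjoint fun q : S => Ioo q.1.1 q.1.2) :=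
    fun p q hpq => hS.disjoint p.2 q.2 (Subtype.coe_injective.ne hpq)
  rw [integral_iUnion (fun _ => measurableSet_Ioo) hd (hφ G inferInstance).integrableOn,
    integral_iUnion (fun _ => measurableSet_Ioo) hd (hφ E.prior inferInstance).integrableOn]
  refine tsum_congr fun q => ?_
  obtain ⟨α, β, hαβ⟩ := haff q q.2
  have key : ∀ μ : Measure I, IsFiniteMeasure μ → ∫ t in Ioo q.1.1 q.1.2, φ t ∂μ
      = μ.real (Ioo q.1.1 q.1.2) * α + β * ∫ t in Ioo q.1.1 q.1.2, (t : ℝ) ∂μ := by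
    intro μ _
    rw [setIntegral_congr_fun measurableSet_Ioo hαβ, integral_add (integrable_const _)
      ((integrable_coe_unitInterval _).const_mul β), integral_const_mul]
    simp
  rw [key G inferInstance, key E.prior inferInstance, measureReal_def, measureReal_def,
    hS.mass q q.2, hS.mean q q.2]

/-- Test the contraction inequality with `max (y - t) 0`. Its kink `y` lies in `q`, so it is affine
on the interior of every other interval; contributions from outside `q` cancel, and the inequality
holds on `q` alone. -/
lemma setIntegral_le_of_mem_MPC (hG : G ∈ E.MPC) (hS : E.IsBiPoolingFamily G S) (hq : q ∈ S)
    {zL zH : I} (hz : signals G q = {zL, zH}) {y : I} (hy : y ∈ Icc q.1 q.2)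
    (hmass : E.prior.real (Icc q.1 y) = G.real {zL}) :
    ∫ ω in Icc q.1 y, (ω : ℝ) ∂E.prior ≤ G.real {zL} * zL := by
  have := hG.1
  set ψ : I → ℝ := fun t => max ((y : ℝ) - t) 0 with hψ
  have hψi : ∀ μ : Measure I, IsFiniteMeasure μ → Integrable ψ μ := fun μ _ =>
    integrable_posPart_sub μ y
  have hout : ∫ t in (Ioo q.1 q.2)ᶜ, ψ t ∂G = ∫ t in (Ioo q.1 q.2)ᶜ, ψ t ∂E.prior := by
    rw [← integral_indicator measurableSet_Ioo.compl, ← integral_indicator measurableSet_Ioo.compl]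
    refine hS.integral_eq (fun μ _ => (hψi μ inferInstance).indicator measurableSet_Ioo.compl)
      fun q' hq' => ?_
    by_cases hqq : q' = q
    · subst hqq
      exact ⟨0, 0, fun t ht => by simp [ht.1, ht.2]⟩
    · have hni : ∀ t ∈ Ioo q'.1 q'.2, t ∈ (Ioo q.1 q.2)ᶜ := fun t ht h =>
        hqq (hS.eq_of_mem hq' hq ht h)
      have hy' : y ∉ Ioo q'.1 q'.2 := fun h => hqq (hS.eq_of_mem_Icc hq' hq h hy)
      by_cases hyq : q'.1 < y
      · have hle : q'.2 ≤ y := not_lt.mp fun h => hy' ⟨hyq, h⟩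
        refine ⟨y, -1, fun t ht => ?_⟩
        rw [indicator_of_mem (hni t ht), hψ]
        have : (t : ℝ) ≤ y := (ht.2.le.trans hle)
        simp only
        rw [max_eq_left (by linarith)]; ring
      · refine ⟨0, 0, fun t ht => ?_⟩
        rw [indicator_of_mem (hni t ht), hψ]
        have : (y : ℝ) ≤ t := (not_lt.mp hyq).trans ht.1.le
        simp only
        rw [max_eq_right (by linarith)]; ring
  have hMPC := (E.mem_MPC_iff.mp hG).1 y
  rw [← integral_add_compl measurableSet_Ioo (hψi G inferInstance),
    ← integral_add_compl measurableSet_Ioo (hψi E.prior inferInstance), hout] at hMPC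
  have hle : ∫ t in Ioo q.1 q.2, ψ t ∂G ≤ ∫ t in Ioo q.1 q.2, ψ t ∂E.prior := by linarith
  have hleft : G.real {zL} * (y - zL) ≤ ∫ t in Ioo q.1 q.2, ψ t ∂G := by
    rw [hS.restrict_Ioo hq]
    calc G.real {zL} * (y - zL) ≤ G.real {zL} * ψ zL :=
          mul_le_mul_of_nonneg_left (le_max_left _ _) measureReal_nonneg
      _ = ∫ t in {zL}, ψ t ∂G := by rw [integral_singleton, smul_eq_mul]
      _ ≤ ∫ t in signals G q, ψ t ∂G :=
          setIntegral_mono_set (hψi G inferInstance).integrableOn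
            (.of_forall fun t => le_max_right _ _)
            (LE.le.eventuallyLE (by rw [hz]; simp))
  have hright : ∫ t in Ioo q.1 q.2, ψ t ∂E.prior
      = y * E.prior.real (Icc q.1 y) - ∫ t in Icc q.1 y, (t : ℝ) ∂E.prior := by
    have hrest : ∫ t in Icc q.1 q.2, ψ t ∂E.prior = ∫ t in Icc q.1 y, ψ t ∂E.prior := by
      refine setIntegral_eq_of_subset_of_forall_sdiff_eq_zero measurableSet_Icc
        (Icc_subset_Icc_right hy.2) ?_
      rintro t ⟨ht, hty⟩
      have : (y : ℝ) < t := not_le.mp fun h => hty ⟨ht.1, h⟩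
      exact max_eq_right (by linarith)
    rw [setIntegral_congr_set Ioo_ae_eq_Icc, hrest,
      setIntegral_congr_fun (f := ψ) measurableSet_Icc (g := fun t : I => (y : ℝ) - t) fun t ht =>
        max_eq_left (sub_nonneg.mpr (show (t : ℝ) ≤ y from ht.2)),
      integral_sub (integrable_const _) (integrable_coe_unitInterval _)]
    simp [mul_comm]
  rw [hright, hmass] at hle
  linarith

/-- Every bi-pooling interval has a nested intervals representation. -/
lemma exists_nested (hG : G ∈ E.MPC) (hS : E.IsBiPoolingFamily G S) (hq : q ∈ S)
    {zL zH : I} (hlt : zL < zH) (hz : signals G q = {zL, zH}) :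
    ∃ CL CH, E.IsBiPartition q.1 q.2 zL zH CL CH ∧ IsNestedIntervals q.1 q.2 CL CH := by
  have := hG.1
  have hpos : ∀ z ∈ signals G q, 0 < G.real {z} := fun z hz =>
    ENNReal.toReal_pos (hS.measure_singleton_ne_zero hq hz) (measure_ne_top _ _)
  have hL := hpos zL (by simp [hz])
  have hH := hpos zH (by simp [hz])
  have hmass : G.real {zL} + G.real {zH} = E.prior.real (Icc q.1 q.2) := by
    rw [measureReal_def E.prior, ← hS.measure_signals hq, hz, insert_eq, ← measureReal_def,
      measureReal_union (by simpa using hlt.ne) (measurableSet_singleton _)]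
  have hmean : G.real {zL} * zL + G.real {zH} * zH = ∫ ω in Icc q.1 q.2, (ω : ℝ) ∂E.prior := by
    rw [← hS.setIntegral_signals hq, hz, setIntegral_pair_coe G hlt.ne]; ring
  obtain ⟨x, y, hax, hxy, hyb, hm, hi⟩ := E.exists_Icc_mass_mean hL hH hlt hmass hmean
    fun y hy h => hS.setIntegral_le_of_mem_MPC hG hq hz hy h
  have hunion : Icc x y ∪ (Icc q.1 x ∪ Icc y q.2) = Icc q.1 q.2 := by
    rw [union_left_comm, Icc_union_Icc_eq_Icc hxy hyb, Icc_union_Icc_eq_Icc hax (hxy.trans hyb)]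
  have hnull : E.prior (Icc x y ∩ (Icc q.1 x ∪ Icc y q.2)) = 0 := by
    refine measure_mono_null (t := {x, y}) ?_ ((Set.toFinite {x, y}).countable.measure_zero _)
    rintro t ⟨h1, h2 | h2⟩
    · exact .inl (le_antisymm h2.2 h1.1)
    · exact .inr (le_antisymm h1.2 h2.1)
  have hclosed : IsClosed (Icc q.1 x ∪ Icc y q.2) := isClosed_Icc.union isClosed_Icc
  have hid := integrable_coe_unitInterval E.prior
  have hmH : E.prior.real (Icc q.1 x ∪ Icc y q.2) = G.real {zH} := by
    have := measureReal_union₀ (μ := E.prior) hclosed.nullMeasurableSet hnull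
    rw [hunion] at this
    linarith
  have hiH : ∫ ω in Icc q.1 x ∪ Icc y q.2, (ω : ℝ) ∂E.prior = G.real {zH} * zH := by
    have := setIntegral_union₀ (μ := E.prior) hnull hclosed.nullMeasurableSet
      hid.integrableOn hid.integrableOn
    rw [hunion] at this
    linarith
  refine ⟨Icc x y, Icc q.1 x ∪ Icc y q.2, ⟨isClosed_Icc, hclosed, hunion, hnull, ?_, ?_⟩,
    x, y, hax, hxy, hyb, rfl, rfl⟩
  · rw [condMean_eq_iff (by rw [hm]; exact hL.ne'), hi, hm, mul_comm]
  · rw [condMean_eq_iff (by rw [hmH]; exact hH.ne'), hiH, hmH, mul_comm]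

end IsBiPoolingFamily

end Environment

/-! ### Existence of canonical representations. -/

namespace Environment

variable {n : ℕ} {E : Environment n} {G : Measure I} {S : Set (I × I)} {N Z : Set I}
  {T : I → Set I}

instance : E.prior.IsOpenPosMeasure := by
  refine ⟨fun U hU hne h => ?_⟩
  obtain ⟨x, hx⟩ := hne
  have hc : ∀ᵐ ω : I ∂E.prior, (-1 : ℝ) < ω → ω ∈ Uᶜ :=
    by filter_upwards [compl_mem_ae_iff.mpr h] with ω hω _ using hω
  exact E.Ici_subset_of_ae (by norm_num) hU.isClosed_compl hc (by linarith [x.2.1]) hx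

/-- The states of a pooling system at which `a_i` is recommended, the revealed states being
assigned to `a_j`. -/
def IsPoolingSystem.region (E : Environment n) (N Z : Set I) (T : I → Set I) (j i : Fin n) :
    Set I :=
  {ω ∈ N | i = j} ∪ ⋃ z ∈ {z ∈ Z | E.level z = i}, T z

/-- The lowest action that `G` recommends with positive probability. -/
lemma exists_lowest_level (E : Environment n) (G : Measure I) [IsProbabilityMeasure G] :
    ∃ j, G {x | E.level x = j} ≠ 0 ∧ ∀ i < j, G {x | E.level x = i} = 0 := by
  have hne : {j | G {x | E.level x = j} ≠ 0}.Nonempty := by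
    by_contra! h
    have h0 : G (⋃ j, {x | E.level x = j}) = 0 :=
      measure_iUnion_null fun j => by_contra fun hj => (h ▸ hj : j ∈ (∅ : Set (Fin n)))
    rw [show (⋃ j, {x | E.level x = j}) = univ by ext; simp, measure_univ] at h0
    exact one_ne_zero h0
  obtain ⟨j, hj, hmin⟩ := WellFounded.has_min (wellFounded_lt (α := Fin n)) _ hne
  exact ⟨j, hj, fun i hi => by_contra fun h => hmin i h hi⟩

section

variable {j : Fin n}

lemma IsOptimal.measure_level_gt (hG : E.IsOptimal G) (hj : G {x | E.level x = j} ≠ 0) {i : Fin n}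
    (hi : j < i) : G {x : I | E.γ i.castSucc < x ∧ E.level x = i} = 0 := by
  refine hG.measure_level_eq_zero E fun h => hj (measure_mono_null (fun x hx => ?_) h)
  have : ¬ i ≤ E.level x := by rw [show E.level x = j from hx]; exact not_le.mpr hi
  rwa [E.le_level_iff, not_le] at this

namespace IsPoolingSystem

lemma le_level (hP : E.IsPoolingSystem G N Z T) (hlow : ∀ i < j, G {x | E.level x = i} = 0)
    {z : I} (hz : z ∈ Z) : j ≤ E.level z := by
  by_contra! h
  exact hP.ne_zero z hz (measure_mono_null (by rintro _ rfl; rfl) (hlow _ h))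

lemma eq_γ (hP : E.IsPoolingSystem G N Z T) (hG : E.IsOptimal G)
    (hj : G {x | E.level x = j} ≠ 0) {z : I} (hz : z ∈ Z) (hlt : j < E.level z) :
    (z : ℝ) = E.γ (E.level z).castSucc := by
  by_contra! h
  have hlt' := lt_of_le_of_ne (E.γ_level_le z) h.symm
  exact hP.ne_zero z hz (measure_mono_null (by rintro _ rfl; exact ⟨hlt', rfl⟩)
    (hG.measure_level_gt hj hlt))

/-- On `N` the prior inherits the null sets of `G`. Under `G` a level above `j` occurs only at its
cutoff, a single point, which the atomless prior ignores. -/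
lemma level_eq_ae (hP : E.IsPoolingSystem G N Z T) (hG : E.IsOptimal G)
    (hj : G {x | E.level x = j} ≠ 0) (hlow : ∀ i < j, G {x | E.level x = i} = 0) :
    ∀ᵐ ω ∂E.prior, ω ∈ N → E.level ω = j := by
  have hNm := hP.isClosed_revealed.measurableSet
  have htrans : ∀ s, G s = 0 → E.prior (s ∩ N) = 0 := fun s hs => by
    rw [← Measure.restrict_apply' hNm, ← hP.reveal, Measure.restrict_apply' hNm]
    exact measure_mono_null inter_subset_left hs
  have key : ∀ i, i ≠ j → ∀ᵐ ω ∂E.prior, ω ∈ N → E.level ω ≠ i := by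
    intro i hi
    rcases lt_or_gt_of_ne hi with h | h
    · filter_upwards [compl_mem_ae_iff.mpr (htrans _ (hlow i h))] with ω hω hN hlev
      exact hω ⟨hlev, hN⟩
    · have hcut : ∀ᵐ ω : I ∂E.prior, (ω : ℝ) ≠ E.γ i.castSucc := by
        rw [ae_iff]
        refine Set.Subsingleton.measure_zero (fun x hx y hy => Subtype.ext ?_) _
        simp only [ne_eq, not_not, mem_ofPred_eq] at hx hy
        rw [hx, hy]
      filter_upwards [compl_mem_ae_iff.mpr (htrans _ (hG.measure_level_gt hj h)), hcut]
        with ω hω hne hN hlev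
      exact hω ⟨⟨lt_of_le_of_ne (hlev ▸ E.γ_level_le ω) hne.symm, hlev⟩, hN⟩
  filter_upwards [ae_all_iff.mpr fun i => ae_all_iff.mpr (key i)] with ω hω hN
  by_contra h
  exact hω _ h hN rfl

/-- By `eq_γ`, all pooled means with a level above the lowest one equal the same cutoff. -/
lemma subsingleton_of_ne (hP : E.IsPoolingSystem G N Z T) (hG : E.IsOptimal G)
    (hj : G {x | E.level x = j} ≠ 0) (hlow : ∀ i < j, G {x | E.level x = i} = 0) {i : Fin n}
    (hi : i ≠ j) : {z ∈ Z | E.level z = i}.Subsingleton := by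
  rintro z ⟨hz, rfl⟩ z' ⟨hz', h⟩
  have hlt := lt_of_le_of_ne (hP.le_level hlow hz) hi.symm
  apply Subtype.ext
  rw [hP.eq_γ hG hj hz hlt, hP.eq_γ hG hj hz' (h ▸ hlt), h]

lemma region_of_ne {i : Fin n} (hi : i ≠ j) :
    region E N Z T j i = ⋃ z ∈ {z ∈ Z | E.level z = i}, T z := by
  simp [region, hi]

lemma region_self : region E N Z T j j = N ∪ ⋃ z ∈ {z ∈ Z | E.level z = j}, T z := by
  simp [region]

lemma subset_region {z : I} (hz : z ∈ Z) : T z ⊆ region E N Z T j (E.level z) :=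
  (subset_biUnion_of_mem (u := T) (show z ∈ {t ∈ Z | E.level t = E.level z} from ⟨hz, rfl⟩)).trans
    subset_union_right

/-- Only the region of `j` can contain infinitely many cells, and assigning the whole of `N` to it
supplies their accumulation points. -/
lemma isClosed_region (hP : E.IsPoolingSystem G N Z T) (hG : E.IsOptimal G)
    (hj : G {x | E.level x = j} ≠ 0) (hlow : ∀ i < j, G {x | E.level x = i} = 0) (i : Fin n) :
    IsClosed (region E N Z T j i) := by
  by_cases hi : i = j
  · subst hi
    rw [region_self]
    exact hP.isClosed_union _ (sep_subset _ _)
  · rw [region_of_ne hi]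
    exact (hP.subsingleton_of_ne hG hj hlow hi).finite.isClosed_biUnion fun z hz => hP.closed z hz.1

lemma iUnion_region (hP : E.IsPoolingSystem G N Z T) : ⋃ i, region E N Z T j i = univ := by
  refine eq_univ_of_forall fun ω => ?_
  rcases hP.cover.symm ▸ mem_univ ω with h | h
  · exact mem_iUnion.mpr ⟨j, .inl ⟨h, rfl⟩⟩
  · simp only [mem_iUnion, exists_prop] at h
    obtain ⟨z, hz, hω⟩ := h
    exact mem_iUnion.mpr ⟨_, subset_region hz hω⟩

lemma null_inter_region (hP : E.IsPoolingSystem G N Z T) {i k : Fin n} (hik : i ≠ k) :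
    E.prior (region E N Z T j i ∩ region E N Z T j k) = 0 := by
  have hae : ∀ᵐ ω ∂E.prior, ω ∉ region E N Z T j i ∩ region E N Z T j k := by
    filter_upwards [hP.ae_disjoint, hP.ae_disjoint_revealed] with ω h1 h2
    simp only [region, mem_inter_iff, mem_union, mem_sep_iff, mem_iUnion, exists_prop, not_and]
    rintro (⟨hN, hi⟩ | ⟨z, ⟨hz, hzi⟩, hω⟩) (⟨hN', hk⟩ | ⟨z', ⟨hz', hzk⟩, hω'⟩)
    · exact hik (hi.trans hk.symm)
    · exact h2 z' hz' hN hω'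
    · exact h2 z hz hN' hω
    · exact h1 z hz z' hz' (fun h => hik (by rw [← hzi, ← hzk, h])) hω hω'
  exact measure_eq_zero_iff_ae_notMem.mpr hae

lemma condMean_region_of_ne (hP : E.IsPoolingSystem G N Z T) (hG : E.IsOptimal G)
    (hj : G {x | E.level x = j} ≠ 0) (hlow : ∀ i < j, G {x | E.level x = i} = 0) {i : Fin n}
    (hi : i ≠ j) (hpos : E.prior (region E N Z T j i) ≠ 0) :
    E.condMean (region E N Z T j i) = E.γ i.castSucc := by
  rw [region_of_ne hi] at hpos ⊢
  rcases (hP.subsingleton_of_ne hG hj hlow hi).eq_empty_or_singleton with h | ⟨z, h⟩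
  · rw [h] at hpos; simp at hpos
  · obtain ⟨hz, rfl⟩ : z ∈ {z ∈ Z | E.level z = i} := h ▸ mem_singleton z
    rw [h, biUnion_singleton] at hpos ⊢
    have hm : E.prior.real (T z) = G.real {z} := by
      rw [measureReal_def, hP.mass z hz, measureReal_def]
    have hlt := lt_of_le_of_ne (hP.le_level hlow hz) hi.symm
    rw [condMean_eq_iff, hP.mean z hz, hm, hP.eq_γ hG hj hz hlt]
    exact (ENNReal.toReal_pos hpos (measure_ne_top _ _)).ne'

lemma le_condMean_region_self (hP : E.IsPoolingSystem G N Z T) (hG : E.IsOptimal G)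
    (hj : G {x | E.level x = j} ≠ 0) (hlow : ∀ i < j, G {x | E.level x = i} = 0)
    (hpos : E.prior (region E N Z T j j) ≠ 0) :
    E.γ j.castSucc ≤ E.condMean (region E N Z T j j) := by
  rw [region_self] at hpos ⊢
  set U := ⋃ z ∈ {z ∈ Z | E.level z = j}, T z with hU
  rw [le_condMean_iff (ENNReal.toReal_pos hpos (measure_ne_top _ _)).ne']
  have hi : ∀ s : Set I, IntegrableOn (fun ω : I => (ω : ℝ) - E.γ j.castSucc) s E.prior := fun s =>
    ((integrable_coe_unitInterval _).sub (integrable_const _)).integrableOn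
  have hsub : ∀ s : Set I, ∫ ω in s, ((ω : ℝ) - E.γ j.castSucc) ∂E.prior
      = ∫ ω in s, (ω : ℝ) ∂E.prior - E.γ j.castSucc * E.prior.real s := fun s => by
    rw [integral_sub (integrable_coe_unitInterval _) (integrable_const _)]
    simp [mul_comm]
  rw [← sub_nonneg, ← hsub]
  have hK : {z ∈ Z | E.level z = j}.Countable := hP.countable.mono (sep_subset _ _)
  have hUm : MeasurableSet U := .biUnion hK fun z hz => hP.measurableSet_cell hz.1
  have hd : AEDisjoint E.prior N U := by
    have hae : ∀ᵐ ω ∂E.prior, ω ∉ N ∩ U := by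
      filter_upwards [hP.ae_disjoint_revealed] with ω hω ⟨hN, hωU⟩
      simp only [hU, mem_iUnion, exists_prop] at hωU
      obtain ⟨z, hz, h⟩ := hωU
      exact hω z hz.1 hN h
    exact measure_eq_zero_iff_ae_notMem.mpr hae
  rw [setIntegral_union₀ hd hUm.nullMeasurableSet (hi _) (hi _)]
  refine add_nonneg ?_ ?_
  · refine setIntegral_nonneg_of_ae_restrict ?_
    rw [Filter.EventuallyLE, ae_restrict_iff' hP.isClosed_revealed.measurableSet]
    filter_upwards [hP.level_eq_ae hG hj hlow] with ω hω hN
    exact sub_nonneg.mpr (hω hN ▸ E.γ_level_le ω)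
  · have := hK.to_subtype
    rw [hU, biUnion_eq_iUnion, integral_iUnion_ae (ι := {z ∈ Z | E.level z = j}) (s := fun z => T z)
      (fun z => (hP.measurableSet_cell z.2.1).nullMeasurableSet)
      (fun z z' hzz => hP.null_inter z z.2.1 z' z'.2.1 (Subtype.coe_injective.ne hzz)) (hi _)]
    refine tsum_nonneg fun z => ?_
    have hm : E.prior.real (T z) = G.real {(z : I)} := by
      rw [measureReal_def, hP.mass z z.2.1, measureReal_def]
    have hγ : E.γ j.castSucc ≤ (z : I) := E.le_level_iff.mp z.2.2.ge
    rw [hsub, hP.mean z z.2.1, hm, ← sub_mul]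
    exact mul_nonneg (sub_nonneg.mpr hγ) measureReal_nonneg

end IsPoolingSystem

end

open IsPoolingSystem in
/-- Every bi-pooling solution has a canonical representation. -/
theorem IsBiPoolingSolution.exists_isCanonicalRep (h : E.IsBiPoolingSolution G) :
    ∃ B : Fin n → Set I, E.IsCanonicalRep G B := by
  obtain ⟨hG, S, hS⟩ := h
  have := hG.1.1
  have hcells : ∀ q : I × I, ∃ T : I → Set I, q ∈ S → E.IsCellFamily G q T ∧
      (∀ z, signals G q = {z} → T z = Icc q.1 q.2) ∧
      ∀ zL zH, zL < zH → signals G q = {zL, zH} →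
        E.IsBiPartition q.1 q.2 zL zH (T zL) (T zH) ∧ IsNestedIntervals q.1 q.2 (T zL) (T zH) := by
    intro q
    by_cases hq : q ∈ S
    · rcases hS.signals_eq hq with ⟨z, hz⟩ | ⟨zL, zH, hlt, hz⟩
      · refine ⟨fun _ => Icc q.1 q.2, fun _ => ⟨hS.isCellFamily_pooling hq hz, fun _ _ => rfl,
          fun zL zH hlt hz' => ?_⟩⟩
        have hL : zL ∈ ({z} : Set I) := by rw [← hz, hz']; simp
        have hH : zH ∈ ({z} : Set I) := by rw [← hz, hz']; simp
        exact absurd (hL.trans hH.symm) hlt.ne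
      · obtain ⟨CL, CH, hC, hnest⟩ := hS.exists_nested hG.1 hq hlt hz
        refine ⟨fun z => if z = zL then CL else CH, fun _ =>
          ⟨hS.isCellFamily_biPooling hq hlt hz hC, fun z hz' => ?_, fun zL' zH' hlt' hz' => ?_⟩⟩
        · have hL : zL ∈ ({z} : Set I) := by rw [← hz', hz]; simp
          have hH : zH ∈ ({z} : Set I) := by rw [← hz', hz]; simp
          exact absurd (hL.trans hH.symm) hlt.ne
        · have hpair : ({zL, zH} : Set I) = {zL', zH'} := hz.symm.trans hz'
          rw [pair_eq_pair_iff] at hpair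
          rcases hpair with ⟨rfl, rfl⟩ | ⟨rfl, rfl⟩
          · simpa [hlt.ne'] using ⟨hC, hnest⟩
          · exact absurd hlt hlt'.not_gt
    · exact ⟨fun _ => ∅, fun h => absurd h hq⟩
  choose T hT using hcells
  have hP := hS.isPoolingSystem fun q hq => (hT q hq).1
  obtain ⟨j, hj, hlow⟩ := E.exists_lowest_level G
  let B := region E (revealedStates S) (pooledMeans G S) (cell S T) j
  have hsubB : ∀ q ∈ S, ∀ z ∈ signals G q, T q z ⊆ B (E.level z) := fun q hq z hz =>
    hS.cell_eq T hq hz ▸ subset_region (mem_biUnion hq hz)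
  have hpair : ∀ q ∈ S, ∀ zL zH : I, zL < zH → (G.restrict (Ioo q.1 q.2)).support = {zL, zH} →
      ∀ iL iH, E.Recommends (zL : ℝ) iL → E.Recommends (zH : ℝ) iH →
        ∃ CL CH, E.IsBiPartition q.1 q.2 zL zH CL CH ∧ IsNestedIntervals q.1 q.2 CL CH ∧
          CL ⊆ B iL ∧ CH ⊆ B iH := by
    intro q hq zL zH hlt hz iL iH hiL hiH
    rw [recommends_iff] at hiL hiH
    subst hiL hiH
    obtain ⟨h1, h2⟩ := (hT q hq).2.2 zL zH hlt hz
    exact ⟨_, _, h1, h2, hsubB q hq zL (by simp [signals, hz]),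
      hsubB q hq zH (by simp [signals, hz])⟩
  refine ⟨B, S, hS, ⟨hP.isClosed_region hG hj hlow, hP.iUnion_region,
    fun i k hik => hP.null_inter_region hik, ?_, ?_, ?_, ?_⟩, hpair⟩
  -- The lowest region with nonempty interior need not be that of `j`, as the latter may have empty
  -- interior. It cannot be lower, and if it is higher then its conditional mean equals the cutoff.
  · intro k hk _
    have hposk : E.prior (B k) ≠ 0 :=
      ((isOpen_interior.measure_pos E.prior hk).trans_le (measure_mono interior_subset)).ne'
    have hjk : j ≤ k := by
      by_contra! hlt
      refine hposk ?_
      have hemp : {z ∈ pooledMeans G S | E.level z = k} = ∅ :=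
        eq_empty_of_forall_notMem fun z hz => (hP.le_level hlow hz.1).not_gt (hz.2 ▸ hlt)
      simp only [B]
      rw [region_of_ne hlt.ne, hemp]
      simp
    refine ⟨?_, fun i hi hposi =>
      hP.condMean_region_of_ne hG hj hlow (hjk.trans_lt hi).ne' hposi⟩
    rcases hjk.eq_or_lt with rfl | hlt
    · exact hP.le_condMean_region_self hG hj hlow hposk
    · exact (hP.condMean_region_of_ne hG hj hlow hlt.ne' hposk).ge
  · filter_upwards [hP.level_eq_ae hG hj hlow] with ω hω hout i hi
    have hN : ω ∈ revealedStates S := by simpa [revealedStates] using hout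
    rw [recommends_iff, hω hN] at hi
    exact .inl ⟨hN, hi⟩
  · intro q hq z hz i hi
    rw [recommends_iff] at hi
    subst hi
    rw [← (hT q hq).2.1 z hz]
    exact hsubB q hq z (by simp [signals, hz])
  · intro q hq zL zH hlt hz iL iH hiL hiH
    obtain ⟨CL, CH, h1, -, h2⟩ := hpair q hq zL zH hlt hz iL iH hiL hiH
    exact ⟨CL, CH, h1, h2⟩

/-! ### From incentive compatibility to implementation, and the conclusion. -/

/-- An incentive compatible canonical representation is the outcome of an equilibrium. -/
theorem IsCanonicalRep.isEquilibriumOutcome {B : Fin n → Set I} [IsFiniteMeasure G]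
    (hB : E.IsCanonicalRep G B) (hIC : E.IsIncentiveCompatible B) :
    E.IsEquilibriumOutcome G (E.designPayoff G) := by
  obtain ⟨S, hS, hdet, -⟩ := hB
  have hcells : ∀ q : I × I, ∃ T : I → Set I, q ∈ S → E.IsCellFamily G q T ∧
      ∀ z ∈ signals G q, T z ⊆ B (E.level z) := by
    intro q
    by_cases hq : q ∈ S
    · rcases hS.signals_eq hq with ⟨z, hz⟩ | ⟨zL, zH, hlt, hz⟩
      · refine ⟨fun _ => Icc q.1 q.2, fun _ => ⟨hS.isCellFamily_pooling hq hz, ?_⟩⟩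
        rw [hz]; rintro _ rfl
        exact hdet.pooling q hq _ hz _ (E.recommends_iff.mpr rfl)
      · obtain ⟨CL, CH, hC, hL, hH⟩ := hdet.biPooling q hq zL zH hlt hz _ _
          (E.recommends_iff.mpr rfl) (E.recommends_iff.mpr rfl)
        refine ⟨fun z => if z = zL then CL else CH, fun _ =>
          ⟨hS.isCellFamily_biPooling hq hlt hz hC, ?_⟩⟩
        rw [hz]
        rintro z (rfl | rfl)
        · simpa using hL
        · simpa [hlt.ne'] using hH
    · exact ⟨fun _ => ∅, fun h => absurd h hq⟩
  choose T hT using hcells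
  refine (hS.isPoolingSystem fun q hq => (hT q hq).1).isEquilibriumOutcome fun z hz => ?_
  have hdisj : ∀ᵐ ω ∂E.prior, ∀ i k, i ≠ k → ω ∈ B i → ω ∉ B k := by
    refine ae_all_iff.mpr fun i => ae_all_iff.mpr fun k => ?_
    by_cases hik : i = k
    · exact .of_forall fun ω h => absurd hik h
    · filter_upwards [compl_mem_ae_iff.mpr (hdet.null_inter i k hik)] with ω hω _ h1 h2
      exact hω ⟨h1, h2⟩
  filter_upwards [hdisj] with ω hω hωz
  simp only [pooledMeans, mem_iUnion, exists_prop] at hz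
  obtain ⟨q, hq, hzq⟩ := hz
  rw [hS.cell_eq T hq hzq] at hωz
  have hBz := (hT q hq).2 z hzq hωz
  -- Incentive compatibility puts `ω` in some `B k` with `k` at least its own level. Almost every
  -- state lies in only one of these sets, so `k` is the level of `z`.
  have := hIC _ (E.mem_A_level ω)
  simp only [mem_iUnion, exists_prop] at this
  obtain ⟨k, hk, ω', hω', heq⟩ := this
  obtain rfl := Subtype.ext heq
  by_contra hlt
  exact hω _ _ (fun h : k = E.level z => hlt (h ▸ hk)) hω' hBz

lemma IsOptimal.commitmentPayoff_eq (hG : E.IsOptimal G) :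
    E.commitmentPayoff = E.designPayoff G :=
  IsGreatest.csSup_eq ⟨mem_image_of_mem _ hG.1, forall_mem_image.mpr hG.2⟩

end Environment

theorem proposition1 {n : ℕ} (E : Environment n) (htop : ∀ i : Fin n, E.γ i.castSucc < 1)
    (G : Measure I) (hG : E.IsBiPoolingSolution G) :
    (∃ B : Fin n → Set I, E.IsCanonicalRep G B) ∧
      ∀ B : Fin n → Set I, E.IsCanonicalRep G B →
        (E.IsImplementable G ↔ E.IsIncentiveCompatible B) := by
  refine ⟨hG.exists_isCanonicalRep, fun B hB => ?_⟩
  have := hG.1.1.1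
  rw [Environment.IsImplementable, hG.1.commitmentPayoff_eq]
  exact ⟨fun h => hB.isIncentiveCompatible htop h.2,
    fun h => ⟨hG.1, hB.isEquilibriumOutcome h⟩⟩
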